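/- **Notation.** Let $\tau\in\mathbb C$ with $\operatorname{Im}\tau>0$, $q^x=e^{2\pi i\tau x}$, $\eta(\tau)=q^{1/24}\prod_{n\ge1}(1-q^n)$, and for real $j$ and $M>0$ $$\theta^{(\pm)}_{j,M}(\tau,z)=\sum_{n\in\mathbb Z}(\pm1)^n q^{M(n+\frac{j}{2M})^2}e^{2\pi iM(n+\frac{j}{2M})z},\qquad \theta_{j,M}=\theta^{(+)}_{j,M}.$$ For a positive integer $m$ put $$\Phi^{*}(z_1,z_2)=\sum_{j\in\mathbb Z}\frac{e^{2\pi imj(z_1+z_2)}q^{mj^2}}{1-e^{2\pi iz_1}q^j}+\sum_{j\in\mathbb Z}\frac{e^{-2\pi imj(z_1+z_2)}q^{mj^2}}{1-e^{-2\pi iz_2}q^j},$$ and, with $E(x)=2\int_0^xe^{-\pi u^2}du$, $$R_{j}(v)=\sum_{n\in j+2m\mathbb Z}\Big\{\operatorname{sgn}\big(n-\tfrac12-j+2m\big)-E\Big(\big(n-2m\tfrac{\operatorname{Im}v}{\operatorname{Im}\tau}\big)\sqrt{\tfrac{\operatorname{Im}\tau}{m}}\Big)\Big\}e^{-\frac{\pi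 in^2\tau}{2m}+2\pi inv},$$ $$\widetilde\Phi^{*}(z_1,z_2)=\Phi^{*}(z_1,z_2)-\tfrac12\sum_{j=0}^{2m-1}R_{j}\big(\tfrac{z_1-z_2}2\big)\,[\theta_{j,m}+\theta_{-j,m}](\tau,z_1+z_2).$$ For $0\le p\le 2m$ let $$G^{(1)[m,p]*}(\tau,z)=(-1)^pq^{-\frac m4}\theta^{(-)}_{p-m-\frac12,m+\frac12}(\tau,0)\,\widetilde\Phi^{*}\big(\tfrac z2+\tfrac\tau2-\tfrac12,\tfrac z2-\tfrac\tau2+\tfrac12\big)-\eta(\tau)^3\frac{[\theta_{p,m+\frac12}+\theta_{-p,m+\frac12}](\tau,z)}{\theta_{0,\frac12}(\tau,z)},$$ $$G^{(2)[m,p]*}(\tau,z)=q^{-\frac m4}\theta^{(-)}_{p-m-\frac12,m+\frac12}(\tau,0)\,\widetilde\Phi^{*}\big(\tfrac z2+\tfrac\tau2,\tfrac z2-\tfrac\tau2\big)-\eta(\tau)^3\frac{[\theta^{(-)}_{p,m+\frac12}+\theta^{(-)}_{-p,m+\frac12}](\tau,z)}{\theta^{(-)}_{0,\frac12}(\tau,z)},$$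 for all $z$ at which neither argument of $\widetilde\Phi^{*}$ lies in $\mathbb Z+\mathbb Z\tau$. In sums over $j,r$ below, $j$ and $r$ run over $\tfrac12\mathbb Z_{\rm odd}=\mathbb Z+\tfrac12$. Write $$S^<[f]=\Big[\sum_{0\le r<j}-\sum_{j\le r<0}\Big]f(j,r),\qquad S^{\le}[f]=\Big[\sum_{0\le r\le j}-\sum_{j<r<0}\Big]f(j,r),$$ $$Q_j=q^{(m+\frac12)(j+\frac{2pm}{2m+1})^2},\qquad \Theta=\theta^{(-)}_{2mp+m+\frac12,\,m+\frac12}(\tau,0).$$ **Proposition.** Let $m\ge1$ and $0\le p\le2m$ be integers and $\operatorname{Im}\tau>0$. For $i=1,2$ there are unique numbers $g^{(i)[m,p]*}_k(\tau)$, $0\le k\le m$, such that $$G^{(i)[m,p]*}(\tau,z)=\sum_{k=0}^m g^{(i)[m,p]*}_k(\tau)\,[\theta_{k,m}+\theta_{-k,m}](\tau,z)$$ for all $z$ as above. They are given as follows, where all double series converge absolutely. 1) (i) For $0<k<m$: $$g^{(1)[m,p]*}_k(\tau)=-S^<\Big[(-1)^{j-\frac12+k}Q_j\,q^{-\frac1{4m}(2mr+k+2mp)^2}\Big]-S^{\le}\Big[(-1)^{j-\frac12+k}Q_j\,q^{-\frac1{4m}(2mr-k+2mp)^2}\Big]-\Theta\sum_{-p<r\le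 p,\ r\in\mathbb Z}(-1)^kq^{-\frac1{4m}(m(2r-1)+k)^2}.$$ (ii) $$2g^{(1)[m,p]*}_0(\tau)=-2\,S^{\le}\Big[(-1)^{j-\frac12}Q_j\,q^{-m(r+p)^2}\Big]-2\,\Theta\sum_{r=0}^{p-1}q^{-m(r+\frac12)^2}.$$ (iii) $$2g^{(1)[m,p]*}_m(\tau)=-2(-1)^m S^{\le}\Big[(-1)^{j-\frac12}Q_j\,q^{-m(r+p-\frac12)^2}\Big]-(-1)^m\,\Theta\sum_{-p<r<p,\ r\in\mathbb Z}q^{-mr^2}.$$ 2) (i) For $0<k<m$: $$g^{(2)[m,p]*}_k(\tau)=-(-1)^pS^<\Big[(-1)^{j-\frac12}Q_j\,q^{-\frac1{4m}(2mr+k+2mp)^2}\Big]-(-1)^pS^{\le}\Big[(-1)^{j-\frac12}Q_j\,q^{-\frac1{4m}(2mr-k+2mp)^2}\Big]-(-1)^p\,\Theta\sum_{-p<r\le p,\ r\in\mathbb Z}q^{-\frac1{4m}(m(2r-1)+k)^2}.$$ (ii) $$2g^{(2)[m,p]*}_0(\tau)=-2(-1)^pS^{\le}\Big[(-1)^{j-\frac12}Q_j\,q^{-m(r+p)^2}\Big]-2(-1)^p\,\Theta\sum_{r=0}^{p-1}q^{-m(r+\frac12)^2}.$$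 (iii) $$2g^{(2)[m,p]*}_m(\tau)=-2(-1)^pS^{\le}\Big[(-1)^{j-\frac12}Q_j\,q^{-m(r+p-\frac12)^2}\Big]-(-1)^p\,\Theta\sum_{-p<r<p,\ r\in\mathbb Z}q^{-mr^2}.$$ -/

import Mathlib

open Complex

noncomputable section

namespace IndefTheta

/-- `q ^ x = exp (2 π i τ x)` for a real exponent `x`. -/
def qpow (τ : ℂ) (x : ℝ) : ℂ := cexp (2 * Real.pi * I * τ * x)

/-- The theta function `θ_{j,M}^{(±)}(τ, z)`: the sum over `n ∈ ℤ` of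
`(±1)^n q^{M (n + j/(2M))²} e^{2πi M (n + j/(2M)) z}`, with `ε = 1` or `ε = -1` for the sign. -/
def theta (ε : ℂ) (j M : ℝ) (τ z : ℂ) : ℂ :=
  ∑' n : ℤ, ε ^ n * qpow τ (M * (n + j / (2 * M)) ^ 2) *
    cexp (2 * Real.pi * I * ((M * (n + j / (2 * M)) : ℝ) : ℂ) * z)

/-- `[θ_{k,m} + θ_{-k,m}](τ, z)`. -/
def thetaSym (k m : ℕ) (τ z : ℂ) : ℂ := theta 1 k m τ z + theta 1 (-k) m τ z

/-- `Φ₁^{[m,0]}(τ, z₁, z₂, 0)`. -/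
def Phi1 (m : ℕ) (τ z₁ z₂ : ℂ) : ℂ :=
  ∑' j : ℤ, cexp (2 * Real.pi * I * m * j * (z₁ + z₂)) * qpow τ (m * (j : ℝ) ^ 2) /
    (1 - cexp (2 * Real.pi * I * z₁) * qpow τ j)

/-- `Φ₂^{[m,0]}(τ, z₁, z₂, 0)`. -/
def Phi2 (m : ℕ) (τ z₁ z₂ : ℂ) : ℂ :=
  ∑' j : ℤ, cexp (-(2 * Real.pi * I * m * j * (z₁ + z₂))) * qpow τ (m * (j : ℝ) ^ 2) /
    (1 - cexp (-(2 * Real.pi * I * z₂)) * qpow τ j)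

/-- `Φ^{[m,0]*} = Φ₁^{[m,0]} + Φ₂^{[m,0]}` at `(τ, z₁, z₂, 0)`. -/
def PhiStar (m : ℕ) (τ z₁ z₂ : ℂ) : ℂ := Phi1 m τ z₁ z₂ + Phi2 m τ z₁ z₂

/-- `E(x) = 2 ∫₀ˣ e^{-π u²} du`. -/
def zwE (x : ℝ) : ℝ := 2 * ∫ u in (0 : ℝ)..x, Real.exp (-Real.pi * u ^ 2)

/-- Zwegers' function `R_{j,m}(τ, v)`: the sum over `n ≡ j mod 2m` (written `n = j + 2ml`) of
`(sgn(n - 1/2 - j + 2m) - E((n - 2m Im v / Im τ) √(Im τ / m))) e^{-πi n² τ/(2m) + 2πi n v}`. -/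
def zwR (j m : ℕ) (τ v : ℂ) : ℂ :=
  ∑' l : ℤ,
    let n : ℝ := j + 2 * m * l
    ((Real.sign (n - 1 / 2 - j + 2 * m)
        - zwE ((n - 2 * m * (v.im / τ.im)) * Real.sqrt (τ.im / m)) : ℝ) : ℂ) *
      cexp (-(Real.pi * I * (n : ℂ) ^ 2 * τ / (2 * m)) + 2 * Real.pi * I * n * v)

/-- Zwegers' correction term `Φ_add^{[m,0]*}(τ, z₁, z₂, 0)`. -/
def PhiAdd (m : ℕ) (τ z₁ z₂ : ℂ) : ℂ :=
  -(1 / 2) * ∑ j ∈ Finset.range (2 * m),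
    zwR j m τ ((z₁ - z₂) / 2) * thetaSym j m τ (z₁ + z₂)

/-- The modified function at `(τ, z₁, z₂, 0)`. -/
def PhiTilde (m : ℕ) (τ z₁ z₂ : ℂ) : ℂ := PhiStar m τ z₁ z₂ + PhiAdd m τ z₁ z₂

def psi1 (m : ℕ) (τ z : ℂ) : ℂ :=
  PhiTilde m τ (z / 2 + τ / 2 - 1 / 2) (z / 2 - τ / 2 + 1 / 2)

def psi2 (m : ℕ) (τ z : ℂ) : ℂ :=
  PhiTilde m τ (z / 2 + τ / 2) (z / 2 - τ / 2)

def Xi1 (m p : ℕ) (τ z : ℂ) : ℂ :=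
  (-1) ^ p * qpow τ (-m / 4) * theta (-1) (p - m - 1 / 2) (m + 1 / 2) τ 0 * psi1 m τ z

def Xi2 (m p : ℕ) (τ z : ℂ) : ℂ :=
  qpow τ (-m / 4) * theta (-1) (p - m - 1 / 2) (m + 1 / 2) τ 0 * psi2 m τ z

def Upsilon1 (m p : ℕ) (τ z : ℂ) : ℂ :=
  ModularForm.eta τ ^ 3 *
    ((theta 1 p (m + 1 / 2) τ z + theta 1 (-p) (m + 1 / 2) τ z) / theta 1 0 (1 / 2) τ z)

def Upsilon2 (m p : ℕ) (τ z : ℂ) : ℂ :=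
  ModularForm.eta τ ^ 3 *
    ((theta (-1) p (m + 1 / 2) τ z + theta (-1) (-p) (m + 1 / 2) τ z) / theta (-1) 0 (1 / 2) τ z)

/-- `G^{(1)[m,p]*}`. -/
def G1 (m p : ℕ) (τ z : ℂ) : ℂ := Xi1 m p τ z - Upsilon1 m p τ z

/-- `G^{(2)[m,p]*}`. -/
def G2 (m p : ℕ) (τ z : ℂ) : ℂ := Xi2 m p τ z - Upsilon2 m p τ z

/-- The lattice `ℤ + ℤτ`; `Φ^{[m,0]*}(τ, z₁, z₂, 0)` has its poles where `z₁` or `z₂` lies in it. -/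
def lattice (τ : ℂ) : Set ℂ := {w | ∃ a b : ℤ, w = a + b * τ}

/-- The points `z` at which `G^{(1)[m,p]*}(τ, z)` is defined. -/
def domain1 (τ : ℂ) : Set ℂ :=
  {z | z / 2 + τ / 2 - 1 / 2 ∉ lattice τ ∧ z / 2 - τ / 2 + 1 / 2 ∉ lattice τ}

/-- The points `z` at which `G^{(2)[m,p]*}(τ, z)` is defined. -/
def domain2 (τ : ℂ) : Set ℂ :=
  {z | z / 2 + τ / 2 ∉ lattice τ ∧ z / 2 - τ / 2 ∉ lattice τ}

/-- The defining property of the functions `g_k^{(1)[m,p]*}(τ)`, `0 ≤ k ≤ m`: they are the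
coefficients of `G^{(1)[m,p]*}(τ, ·)` with respect to the functions `θ_{k,m} + θ_{-k,m}`. -/
def IsCoeff1 (m p : ℕ) (τ : ℂ) (g : Fin (m + 1) → ℂ) : Prop :=
  ∀ z ∈ domain1 τ, G1 m p τ z = ∑ k : Fin (m + 1), g k * thetaSym k m τ z

/-- The defining property of the functions `g_k^{(2)[m,p]*}(τ)`, `0 ≤ k ≤ m`. -/
def IsCoeff2 (m p : ℕ) (τ : ℂ) (g : Fin (m + 1) → ℂ) : Prop :=
  ∀ z ∈ domain2 τ, G2 m p τ z = ∑ k : Fin (m + 1), g k * thetaSym k m τ z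

/-- The half-odd number `n + 1/2`. Pairs `(j, r)` of half-odd numbers are parametrized by
`x : ℤ × ℤ` through `j = half x.1`, `r = half x.2`. -/
def half (n : ℤ) : ℝ := n + 1 / 2

/-- `0 ≤ r < j`. -/
def posStrict : Set (ℤ × ℤ) := {x | 0 ≤ half x.2 ∧ half x.2 < half x.1}

/-- `j ≤ r < 0`. -/
def negStrict : Set (ℤ × ℤ) := {x | half x.1 ≤ half x.2 ∧ half x.2 < 0}

/-- `0 ≤ r ≤ j`. -/
def posWeak : Set (ℤ × ℤ) := {x | 0 ≤ half x.2 ∧ half x.2 ≤ half x.1}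

/-- `j < r < 0`. -/
def negWeak : Set (ℤ × ℤ) := {x | half x.1 < half x.2 ∧ half x.2 < 0}

/-- The sum of `f` over `0 ≤ r < j` minus its sum over `j ≤ r < 0`. -/
def sumStrict (f : ℤ × ℤ → ℂ) : ℂ := ∑' x : posStrict, f x - ∑' x : negStrict, f x

/-- The sum of `f` over `0 ≤ r ≤ j` minus its sum over `j < r < 0`. -/
def sumWeak (f : ℤ × ℤ → ℂ) : ℂ := ∑' x : posWeak, f x - ∑' x : negWeak, f x

def SummableStrict (f : ℤ × ℤ → ℂ) : Prop :=
  Summable (fun x : posStrict => f x) ∧ Summable (fun x : negStrict => f x)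

def SummableWeak (f : ℤ × ℤ → ℂ) : Prop :=
  Summable (fun x : posWeak => f x) ∧ Summable (fun x : negWeak => f x)

/-- `(-1)^{j - 1/2} q^{(m + 1/2)(j + 2pm/(2m+1))²} q^{-[2mr + c + 2mp]²/(4m)}`
at `j = half x.1`, `r = half x.2`. -/
def term (m p : ℕ) (c : ℝ) (τ : ℂ) (x : ℤ × ℤ) : ℂ :=
  (-1) ^ x.1 * qpow τ ((m + 1 / 2) * (half x.1 + 2 * p * m / (2 * m + 1)) ^ 2) *
    qpow τ (-(1 / (4 * m)) * (2 * m * half x.2 + c + 2 * m * p) ^ 2)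

/-- `(-1)^{j - 1/2} q^{(m + 1/2)(j + 2pm/(2m+1))² - m(r + p + d)²}`
at `j = half x.1`, `r = half x.2`. -/
def termSq (m p : ℕ) (d : ℝ) (τ : ℂ) (x : ℤ × ℤ) : ℂ :=
  (-1) ^ x.1 * qpow τ ((m + 1 / 2) * (half x.1 + 2 * p * m / (2 * m + 1)) ^ 2 -
    m * (half x.2 + p + d) ^ 2)

/-- The theta constant `θ^{(-)}_{2mp + m + 1/2, m + 1/2}(τ, 0)`. -/
def thetaConst (m p : ℕ) (τ : ℂ) : ℂ :=
  theta (-1) (2 * m * p + m + 1 / 2) (m + 1 / 2) τ 0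

end IndefTheta

end

noncomputable section

namespace IndefTheta

open Filter Topology

/-! ### Powers of `q` and Gaussian series -/

/-! The completed Appell function contributes nothing. At `z₁ - z₂ = τ` the poles of the two halves
of Φ* cancel termwise, leaving a finite combination of theta functions (`PhiStar_eq`), and Zwegers'
correction is exactly its negative (`psi2_eq_zero`). Hence G⁽²⁾ is minus the quotient of theta
functions, and G⁽¹⁾ is the same function at `z + 1` up to the sign `(-1)^p` (`psi1_eq`,
`Upsilon1_eq`). The task is to expand the quotient in the functions θ_{k,m} + θ_{-k,m}.

In the strip `|Im z| < Im τ` the reciprocal η³/θ is a double series over a cone minus the opposite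
cone (`recip`). Multiplying it by θ_{e,m+1/2} gives Laurent coefficients `quotCoeff m e N` which are
again signed cone sums, now of an indefinite theta series (`hasSum_quotCoeff`). The case of index
zero of this computation, with Jacobi's series for η³, shows that `recip` really is the reciprocal
(`recip_mul_theta`).

Everything else comes from moving the vertex of the cone. Each row of the double series sums to zero
by antisymmetry, so the vertex moves freely in `l`; moving it in `j` costs columns, each a theta
constant times a power of `q`. Combined with a shift symmetry this gives a quasi-periodicity in `N`
with one column as error (`quotCoeff_add_two_mul`). The errors for `e = p` and `e = -p` cancel, so
the normalised coefficients `symCoeff` are even and periodic modulo `2m`: precisely what makes a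
Laurent series a combination of the θ_{k,m}. The identity theorem carries this from the strip to all
`z`.

Moving the vertex to `j = p` for `e = p` and to `j = -p` for `e = -p` turns the cone sums into the
sums over `r ≤ j` and `r < j`; the columns crossed give the finite sums times Θ (`symCoeff_eq`,
`symCoeff_zero`, `symCoeff_self`). Uniqueness is orthogonality of characters on the real interval
`[0, 2]`. -/

lemma qpow_add (τ : ℂ) (x y : ℝ) : qpow τ (x + y) = qpow τ x * qpow τ y := by
  simp only [qpow, ← Complex.exp_add]; push_cast; ring_nf

@[simp] lemma qpow_zero (τ : ℂ) : qpow τ 0 = 1 := by simp [qpow]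

lemma qpow_ne_zero (τ : ℂ) (x : ℝ) : qpow τ x ≠ 0 := Complex.exp_ne_zero _

lemma qpow_neg (τ : ℂ) (x : ℝ) : qpow τ (-x) = (qpow τ x)⁻¹ := by
  simp only [qpow, ← Complex.exp_neg]; push_cast; ring_nf

lemma qpow_add_left (z w : ℂ) (x : ℝ) : qpow (z + w) x = qpow z x * qpow w x := by
  simp only [qpow, ← Complex.exp_add]; ring_nf

lemma qpow_mul_int (τ : ℂ) (x : ℝ) (n : ℤ) : qpow τ (n * x) = qpow τ x ^ n := by
  simp only [qpow, ← Complex.exp_int_mul]; push_cast; ring_nf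

lemma qpow_mul_nat (τ : ℂ) (x : ℝ) (n : ℕ) : qpow τ (n * x) = qpow τ x ^ n := by
  exact_mod_cast qpow_mul_int τ x n

lemma qpow_one_int (n : ℤ) : qpow 1 n = 1 := by
  rw [qpow, Complex.exp_eq_one_iff]
  exact ⟨n, by push_cast; ring⟩

lemma qpow_one_int_div_two (n : ℤ) : qpow 1 (n / 2) = (-1) ^ n := by
  rw [div_eq_mul_inv, qpow_mul_int]
  congr 1
  rw [qpow, ← Complex.exp_pi_mul_I]
  congr 1; push_cast; ring

lemma norm_qpow (τ : ℂ) (x : ℝ) : ‖qpow τ x‖ = Real.exp (-(2 * Real.pi * τ.im * x)) := by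
  rw [qpow, Complex.norm_exp]
  congr 1
  simp

lemma norm_neg_one_zpow (n : ℤ) : ‖(-1 : ℂ) ^ n‖ = 1 := by simp

lemma summable_exp_quadratic {a : ℝ} (ha : 0 < a) (b c : ℝ) :
    Summable fun n : ℤ => Real.exp (-a * n ^ 2 + b * n + c) := by
  -- With these arguments the `n`-th term of `jacobiTheta₂` has norm `exp (-a n² + b n)`.
  have h := (summable_jacobiTheta₂_term_iff (-(b / (2 * Real.pi)) * I) (a / Real.pi * I)).mpr
    (by simp; positivity)
  have h2 := h.norm.mul_right (Real.exp c)
  refine h2.congr fun n => ?_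
  rw [norm_jacobiTheta₂_term, ← Real.exp_add]
  congr 1
  have : Real.pi ≠ 0 := Real.pi_ne_zero
  have e1 : (↑a / ↑Real.pi * I : ℂ).im = a / Real.pi := by
    rw [← Complex.ofReal_div]; simp
  have e2 : (-(↑b / (2 * ↑Real.pi)) * I : ℂ).im = -(b / (2 * Real.pi)) := by
    have : (-(↑b / (2 * ↑Real.pi)) * I : ℂ) = ((-(b / (2 * Real.pi)) : ℝ) : ℂ) * I := by
      push_cast; ring
    rw [this, Complex.im_ofReal_mul, Complex.I_im, mul_one]
  rw [e1, e2]
  field_simp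
  ring

lemma abs_le_exp_add_exp_neg (x : ℝ) : |x| ≤ Real.exp x + Real.exp (-x) := by
  rw [abs_le]
  have h1 := Real.add_one_le_exp x
  have h2 := Real.add_one_le_exp (-x)
  have h3 := Real.exp_pos x
  have h4 := Real.exp_pos (-x)
  constructor <;> linarith

lemma summable_abs_mul_exp_quadratic {a : ℝ} (ha : 0 < a) (b c : ℝ) :
    Summable fun n : ℤ => |(n : ℝ)| * Real.exp (-a * n ^ 2 + b * n + c) := by
  refine Summable.of_nonneg_of_le (fun n => by positivity) (fun n => ?_)
    ((summable_exp_quadratic ha (b + 1) c).add (summable_exp_quadratic ha (b - 1) c))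
  calc _ ≤ (Real.exp n + Real.exp (-n)) * Real.exp (-a * n ^ 2 + b * n + c) := by
        gcongr; exact abs_le_exp_add_exp_neg _
    _ = _ := by
        rw [add_mul, ← Real.exp_add, ← Real.exp_add]; ring_nf

/-! ### Theta series -/

lemma theta_eq_tsum (ε : ℂ) (j M : ℝ) (τ z : ℂ) :
    theta ε j M τ z = ∑' n : ℤ, ε ^ n * qpow τ (M * (n + j / (2 * M)) ^ 2) *
      qpow z (M * (n + j / (2 * M))) := by
  unfold theta
  refine tsum_congr fun n => ?_
  congr 1
  unfold qpow; congr 1; ring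

lemma summable_theta_term_norm {ε : ℂ} (hε : ‖ε‖ = 1) (j : ℝ) {M : ℝ} (hM : 0 < M) {τ : ℂ}
    (hτ : 0 < τ.im) (z : ℂ) :
    Summable fun n : ℤ => ‖ε ^ n * qpow τ (M * (n + j / (2 * M)) ^ 2) *
      qpow z (M * (n + j / (2 * M)))‖ := by
  have hπ := Real.pi_pos
  refine (summable_exp_quadratic (a := 2 * Real.pi * τ.im * M) (by positivity)
    (-(2 * Real.pi * (τ.im * j + z.im * M)))
    (-(2 * Real.pi * (τ.im * j ^ 2 / (4 * M) + z.im * j / 2)))).congr fun n => ?_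
  rw [norm_mul, norm_mul, norm_zpow, hε, one_zpow, one_mul, norm_qpow, norm_qpow, ← Real.exp_add]
  congr 1
  field_simp
  ring

/-- Expanding the square makes the theta series a multiple of `jacobiTheta₂`, whose
differentiability in the first variable is then available. -/
lemma theta_eq_jacobiTheta₂ (j : ℝ) {M : ℝ} (hM : 0 < M) (τ z : ℂ) :
    theta 1 j M τ z = qpow τ (j ^ 2 / (4 * M)) * qpow z (j / 2) *
      jacobiTheta₂ (M * z + j * τ) (2 * M * τ) := by
  rw [theta_eq_tsum, jacobiTheta₂, ← tsum_mul_left]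
  refine tsum_congr fun n => ?_
  rw [one_zpow, one_mul, jacobiTheta₂_term]
  simp only [qpow, ← Complex.exp_add]
  congr 1
  have : (M : ℂ) ≠ 0 := by exact_mod_cast hM.ne'
  push_cast
  field_simp
  ring

lemma qpow_differentiable (x : ℝ) : Differentiable ℂ fun z => qpow z x := by
  unfold qpow; fun_prop

lemma theta_differentiable (j : ℝ) {M : ℝ} (hM : 0 < M) {τ : ℂ} (hτ : 0 < τ.im) :
    Differentiable ℂ (theta 1 j M τ) := by
  have : theta 1 j M τ = fun z => qpow τ (j ^ 2 / (4 * M)) * qpow z (j / 2) *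
      jacobiTheta₂ (M * z + j * τ) (2 * M * τ) := by
    ext z; exact theta_eq_jacobiTheta₂ j hM τ z
  rw [this]
  refine ((qpow_differentiable _).const_mul _).mul fun z => ?_
  have h : 0 < (2 * M * τ : ℂ).im := by
    have : (2 * M * τ : ℂ) = ((2 * M : ℝ) : ℂ) * τ := by push_cast; ring
    rw [this, Complex.im_ofReal_mul]
    positivity
  exact (differentiableAt_jacobiTheta₂_fst _ h).comp z (by fun_prop)

/-- A shift of `z` by one turns the alternating theta series into the plain one. -/
lemma theta_add_one (ε : ℂ) (a : ℤ) (b : ℕ) (hb : 0 < b) (τ z : ℂ) :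
    theta ε a (b / 2) τ (z + 1) = (-1) ^ a * theta (ε * (-1) ^ b) a (b / 2) τ z := by
  rw [theta_eq_tsum, theta_eq_tsum, ← tsum_mul_left]
  refine tsum_congr fun n => ?_
  have hb' : (b : ℝ) ≠ 0 := by positivity
  have e : (b / 2 : ℝ) * (n + a / (2 * (b / 2))) = ((b * n + a : ℤ) : ℝ) / 2 := by
    push_cast; field_simp
  rw [e, qpow_add_left, qpow_one_int_div_two, zpow_add₀ (by norm_num), zpow_mul, mul_zpow,
    zpow_natCast]
  ring

/-- For odd `b` the shift by one exchanges the alternating and the plain series, so the alternating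
case reduces to the plain one. -/
lemma theta_neg_one_differentiable (a : ℤ) (b : ℕ) (hb : Odd b) {τ : ℂ} (hτ : 0 < τ.im) :
    Differentiable ℂ (theta (-1) a (b / 2) τ) := by
  have hb0 : 0 < b := hb.pos
  have : theta (-1) a (b / 2) τ = fun z => (-1) ^ a * theta 1 a (b / 2) τ (z + 1) := by
    ext z
    rw [theta_add_one _ _ _ hb0, hb.neg_one_pow, one_mul, ← mul_assoc, ← mul_zpow]
    simp
  rw [this]
  have h := theta_differentiable a (M := b / 2) (by positivity) hτ
  exact (h.comp (by fun_prop : Differentiable ℂ fun z : ℂ => z + 1)).const_mul _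

/-! ### Gaussian binomials and the finite triple product -/

/-- The finite product `(1 - q) ⋯ (1 - qⁿ)`. -/
def qFact (τ : ℂ) (n : ℕ) : ℂ := ∏ i ∈ Finset.range n, (1 - qpow τ 1 ^ (i + 1))

/-- Gaussian binomial coefficients, through their Pascal recursion. -/
def qChoose (τ : ℂ) : ℕ → ℕ → ℂ
  | _, 0 => 1
  | 0, _ + 1 => 0
  | n + 1, k + 1 => qChoose τ n k + qpow τ 1 ^ (k + 1) * qChoose τ n (k + 1)

lemma qChoose_eq_zero (τ : ℂ) : ∀ {n k : ℕ}, n < k → qChoose τ n k = 0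
  | _, 0, h => by omega
  | 0, _ + 1, _ => by simp [qChoose]
  | n + 1, k + 1, h => by
    rw [qChoose, qChoose_eq_zero τ (by omega), qChoose_eq_zero τ (by omega)]; simp

lemma qFact_succ (τ : ℂ) (n : ℕ) : qFact τ (n + 1) = qFact τ n * (1 - qpow τ 1 ^ (n + 1)) :=
  Finset.prod_range_succ _ _

/-- Stated without division, so that the Pascal recursion proves it for every `τ`, also where `q` is
a root of unity. -/
lemma qChoose_mul_qFact (τ : ℂ) : ∀ n k : ℕ,
    qChoose τ (n + k) k * (qFact τ k * qFact τ n) = qFact τ (n + k)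
  | _, 0 => by simp [qChoose, qFact]
  | 0, k + 1 => by
    have h := qChoose_mul_qFact τ 0 k
    simp only [zero_add] at h ⊢
    rw [qChoose, qChoose_eq_zero τ (Nat.lt_succ_self k), qFact_succ]
    have h0 : qFact τ 0 = 1 := by simp [qFact]
    rw [h0] at h ⊢
    linear_combination (1 - qpow τ 1 ^ (k + 1)) * h
  | n + 1, k + 1 => by
    have h1 := qChoose_mul_qFact τ (n + 1) k
    have h2 := qChoose_mul_qFact τ n (k + 1)
    rw [show n + (k + 1) = n + 1 + k by ring] at h2
    rw [show n + 1 + (k + 1) = (n + 1 + k) + 1 by ring, qChoose, qFact_succ τ (n + 1 + k),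
      show qpow τ 1 ^ (n + 1 + k + 1) = qpow τ 1 ^ (k + 1) * qpow τ 1 ^ (n + 1) by ring]
    rw [qFact_succ τ k] at h2 ⊢
    rw [qFact_succ τ n] at h1 ⊢
    linear_combination (1 - qpow τ 1 ^ (k + 1)) * h1 +
      qpow τ 1 ^ (k + 1) * (1 - qpow τ 1 ^ (n + 1)) * h2

lemma qpow_natCast (τ : ℂ) (n : ℕ) : qpow τ n = qpow τ 1 ^ n := by
  rw [← qpow_mul_nat, mul_one]

/-- The finite `q`-binomial theorem. -/
lemma prod_one_sub_mul_qpow (τ : ℂ) (N : ℕ) : ∀ y : ℂ,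
    ∏ i ∈ Finset.range N, (1 - y * qpow τ i) =
      ∑ k ∈ Finset.range (N + 1), (-1) ^ k * qChoose τ N k * qpow τ (k * (k - 1) / 2) * y ^ k := by
  induction N with
  | zero => intro y; simp [qChoose]
  | succ N ih =>
    intro y
    rw [Finset.prod_range_succ']
    have h1 : ∏ i ∈ Finset.range N, (1 - y * qpow τ ((i + 1 : ℕ) : ℝ)) =
        ∏ i ∈ Finset.range N, (1 - (y * qpow τ 1) * qpow τ i) := by
      refine Finset.prod_congr rfl fun i _ => ?_
      rw [mul_assoc, ← qpow_add]; push_cast; ring_nf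
    rw [h1, ih]
    -- The summand of the induction hypothesis at `y q`. By Pascal's rule the summand for `N + 1` at
    -- `k + 1` is `f (k + 1) - y f k`, which is multiplication by the split-off factor `1 - y`.
    set f : ℕ → ℂ := fun k =>
      (-1) ^ k * qChoose τ N k * qpow τ (k * (k - 1) / 2) * (y * qpow τ 1) ^ k with hf
    have hf0 : f (N + 1) = 0 := by simp [hf, qChoose_eq_zero τ (Nat.lt_succ_self N)]
    have h2 : ∑ k ∈ Finset.range (N + 1), f k = 1 + ∑ k ∈ Finset.range (N + 1), f (k + 1) := by
      have := Finset.sum_range_succ f (N + 1)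
      rw [hf0, add_zero] at this
      rw [← this, Finset.sum_range_succ', add_comm]
      simp [hf, qChoose]
    rw [Finset.sum_range_succ' _ (N + 1)]
    have h3 : ∀ k : ℕ, (-1) ^ (k + 1) * qChoose τ (N + 1) (k + 1) *
        qpow τ (((k + 1 : ℕ) : ℝ) * (((k + 1 : ℕ) : ℝ) - 1) / 2) * y ^ (k + 1) =
        f (k + 1) - y * f k := by
      intro k
      have e : qpow τ (((k + 1 : ℕ) : ℝ) * (((k + 1 : ℕ) : ℝ) - 1) / 2) =
          qpow τ (k * (k - 1) / 2) * qpow τ 1 ^ k := by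
        rw [← qpow_natCast, ← qpow_add]; push_cast; ring_nf
      simp only [hf, qChoose, e, mul_pow]
      ring
    rw [Finset.sum_congr rfl fun k _ => h3 k, Finset.sum_sub_distrib, ← Finset.mul_sum, h2]
    simp [qChoose]
    ring

/-- The finite form of Jacobi's triple product. -/
lemma finite_triple_product (τ : ℂ) (n : ℕ) {t : ℂ} (ht : t ≠ 0) :
    (∏ i ∈ Finset.range n, (1 - t * qpow τ (i + 1))) *
        ∏ i ∈ Finset.range n, (1 - t⁻¹ * qpow τ i) =
      ∑ κ ∈ Finset.Icc (-(n : ℤ)) n, qChoose τ (2 * n) (n + κ).toNat *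
        ((-1) ^ κ * qpow τ (κ * (κ + 1) / 2) * t ^ κ) := by
  -- At `y = t q^(1-n)` the last `n` of the `2n` factors are `1 - t q^(i+1)`. The first `n`, read
  -- backwards, are `1 - t q^(-i) = -t q^(-i) (1 - t⁻¹ q^i)`.
  have h := prod_one_sub_mul_qpow τ (2 * n) (t * qpow τ (1 - n))
  rw [two_mul, Finset.prod_range_add] at h
  have h1 : ∏ i ∈ Finset.range n, (1 - t * qpow τ (1 - n) * qpow τ ((n + i : ℕ) : ℝ)) =
      ∏ i ∈ Finset.range n, (1 - t * qpow τ (i + 1)) := by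
    refine Finset.prod_congr rfl fun i _ => ?_
    rw [mul_assoc, ← qpow_add]; push_cast; ring_nf
  have h2 : ∏ i ∈ Finset.range n, (1 - t * qpow τ (1 - n) * qpow τ i) =
      (-t) ^ n * qpow τ (-(n * (n - 1) / 2)) * ∏ i ∈ Finset.range n, (1 - t⁻¹ * qpow τ i) := by
    have e : ∀ n : ℕ, (-t) ^ n * qpow τ (-(n * (n - 1) / 2)) =
        ∏ i ∈ Finset.range n, (-t * qpow τ (-i)) := by
      intro n
      induction n with
      | zero => simp
      | succ n ih =>
        rw [Finset.prod_range_succ, ← ih, pow_succ,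
          show -(((n + 1 : ℕ) : ℝ) * (((n + 1 : ℕ) : ℝ) - 1) / 2) = -(n * (n - 1) / 2) + -n by
            push_cast; ring, qpow_add]
        ring
    rw [e, ← Finset.prod_mul_distrib, ← Finset.prod_range_reflect]
    refine Finset.prod_congr rfl fun i hi => ?_
    have hi' := Finset.mem_range.mp hi
    rw [mul_assoc, ← qpow_add, qpow_neg]
    have : (1 - n + ((n - 1 - i : ℕ) : ℝ) : ℝ) = -i := by
      rw [Nat.sub_sub, Nat.cast_sub (by omega)]; push_cast; ring
    rw [this, qpow_neg]
    have := qpow_ne_zero τ i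
    field_simp
    ring
  rw [h1, h2] at h
  have hc : (-t) ^ n * qpow τ (-(n * (n - 1) / 2)) ≠ 0 :=
    mul_ne_zero (pow_ne_zero _ (neg_ne_zero.mpr ht)) (qpow_ne_zero _ _)
  refine mul_left_cancel₀ hc ?_
  have hs : ∑ k ∈ Finset.range (n + n + 1), (-1) ^ k * qChoose τ (n + n) k *
      qpow τ (k * (k - 1) / 2) * (t * qpow τ (1 - n)) ^ k =
      (-t) ^ n * qpow τ (-(n * (n - 1) / 2)) *
        ∑ κ ∈ Finset.Icc (-(n : ℤ)) n, qChoose τ (2 * n) (n + κ).toNat *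
          ((-1) ^ κ * qpow τ (κ * (κ + 1) / 2) * t ^ κ) := by
    rw [Finset.mul_sum]
    refine Finset.sum_nbij' (fun k : ℕ => (k : ℤ) - n) (fun κ => (n + κ).toNat) ?_ ?_ ?_ ?_ ?_
    · intro k hk; simp only [Finset.mem_range, Finset.mem_Icc] at *; omega
    · intro k hk; simp only [Finset.mem_range, Finset.mem_Icc] at *; omega
    · intro k hk; simp
    · intro k hk; simp only [Finset.mem_Icc] at hk; omega
    · intro k hk
      have e1 : ((n : ℤ) + (k - n)).toNat = k := by simp
      have e2 : (-t) ^ n = (-1) ^ n * t ^ n := neg_pow t n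
      rw [e1, zpow_sub₀ (by norm_num), zpow_sub₀ ht, two_mul, mul_pow, ← qpow_mul_nat, e2]
      simp only [zpow_natCast]
      have e4 : qpow τ (k * (k - 1) / 2) * qpow τ (k * (1 - n)) =
          qpow τ (-(n * (n - 1) / 2)) * qpow τ (((k - n : ℤ) : ℝ) * (((k - n : ℤ) : ℝ) + 1) / 2) := by
        rw [← qpow_add, ← qpow_add]; push_cast; ring_nf
      have ht' := pow_ne_zero n ht
      have h1' : ((-1 : ℂ) ^ n) ≠ 0 := pow_ne_zero _ (by norm_num)
      field_simp
      linear_combination qChoose τ (n + n) k * e4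
  rw [← hs, ← h]
  ring

/-! ### Passing to the limit -/

lemma norm_qpow_one_lt {τ : ℂ} (hτ : 0 < τ.im) : ‖qpow τ 1‖ < 1 := by
  rw [norm_qpow, Real.exp_lt_one_iff]
  have := Real.pi_pos
  have : 0 < 2 * Real.pi * τ.im * 1 := by positivity
  linarith

/-- The infinite product `∏ (1 - qⁿ)`. -/
def eulerProd (τ : ℂ) : ℂ := ∏' i : ℕ, (1 - qpow τ 1 ^ (i + 1))

lemma multipliable_one_sub_mul_geometric {q : ℂ} (hq : ‖q‖ < 1) (a : ℂ) :
    Multipliable fun i : ℕ => 1 - a * q ^ i := by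
  have h : Summable fun i : ℕ => ‖-(a * q ^ i)‖ := by
    simpa using (summable_geometric_of_lt_one (norm_nonneg _) hq).mul_left ‖a‖
  simpa [sub_eq_add_neg] using multipliable_one_add_of_summable h

lemma tprod_one_sub_mul_geometric_ne_zero {q : ℂ} (hq : ‖q‖ < 1) {a : ℂ}
    (ha : ∀ i : ℕ, 1 - a * q ^ i ≠ 0) : ∏' i : ℕ, (1 - a * q ^ i) ≠ 0 := by
  have h : Summable fun i : ℕ => ‖-(a * q ^ i)‖ := by
    simpa using (summable_geometric_of_lt_one (norm_nonneg _) hq).mul_left ‖a‖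
  have := tprod_one_add_ne_zero_of_summable (f := fun i : ℕ => -(a * q ^ i))
    (by intro i; simpa [sub_eq_add_neg] using ha i) h
  simpa [sub_eq_add_neg] using this

lemma one_sub_pow_ne_zero {q : ℂ} (hq : ‖q‖ < 1) (i : ℕ) : 1 - q ^ (i + 1) ≠ 0 := by
  rw [sub_ne_zero]
  intro h
  have := pow_lt_one₀ (norm_nonneg _) hq (Nat.succ_ne_zero i)
  rw [← norm_pow, Nat.succ_eq_add_one, ← h] at this
  simp at this

lemma eulerProd_ne_zero {τ : ℂ} (hτ : 0 < τ.im) : eulerProd τ ≠ 0 := by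
  have h := tprod_one_sub_mul_geometric_ne_zero (norm_qpow_one_lt hτ) (a := qpow τ 1)
    (fun i => by rw [← pow_succ']; exact one_sub_pow_ne_zero (norm_qpow_one_lt hτ) i)
  simpa [eulerProd, pow_succ'] using h

lemma tendsto_qFact {τ : ℂ} (hτ : 0 < τ.im) : Tendsto (qFact τ) atTop (𝓝 (eulerProd τ)) := by
  have h := (multipliable_one_sub_mul_geometric (norm_qpow_one_lt hτ) (qpow τ 1)).hasProd
  have e : qFact τ = fun n => ∏ i ∈ Finset.range n, (1 - qpow τ 1 * qpow τ 1 ^ i) := by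
    ext n; simp only [qFact, pow_succ']
  rw [e]
  simpa [eulerProd, pow_succ'] using h.tendsto_prod_nat

lemma qFact_ne_zero {τ : ℂ} (hτ : 0 < τ.im) (n : ℕ) : qFact τ n ≠ 0 :=
  Finset.prod_ne_zero_iff.mpr fun i _ => one_sub_pow_ne_zero (norm_qpow_one_lt hτ) i

lemma qChoose_eq_div {τ : ℂ} (hτ : 0 < τ.im) (n k : ℕ) :
    qChoose τ (n + k) k = qFact τ (n + k) / (qFact τ k * qFact τ n) := by
  rw [eq_div_iff (mul_ne_zero (qFact_ne_zero hτ _) (qFact_ne_zero hτ _)), qChoose_mul_qFact]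

/-- The products `qFact τ n` and their inverses converge, hence are bounded. This is the domination
needed to pass to the limit in the finite triple product. -/
lemma exists_norm_qChoose_le {τ : ℂ} (hτ : 0 < τ.im) : ∃ C, ∀ n k, ‖qChoose τ n k‖ ≤ C := by
  obtain ⟨A, hA⟩ := (tendsto_qFact hτ).norm.bddAbove_range
  obtain ⟨B, hB⟩ := ((tendsto_qFact hτ).inv₀ (eulerProd_ne_zero hτ)).norm.bddAbove_range
  have hA' : ∀ n, ‖qFact τ n‖ ≤ A := fun n => hA ⟨n, rfl⟩
  have hB' : ∀ n, ‖(qFact τ n)⁻¹‖ ≤ B := fun n => hB ⟨n, rfl⟩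
  have A0 : 0 ≤ A := (norm_nonneg _).trans (hA' 0)
  have B0 : 0 ≤ B := (norm_nonneg _).trans (hB' 0)
  refine ⟨A * (B * B), fun n k => ?_⟩
  rcases lt_or_ge n k with h | h
  · rw [qChoose_eq_zero τ h, norm_zero]; positivity
  · obtain ⟨l, rfl⟩ := Nat.exists_eq_add_of_le' h
    rw [qChoose_eq_div hτ, div_eq_mul_inv, mul_inv, norm_mul, norm_mul]
    exact mul_le_mul (hA' _) (mul_le_mul (hB' _) (hB' _) (norm_nonneg _) B0) (by positivity) A0

/-- Tannery's theorem for sums weighted by central Gaussian binomials. -/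
lemma tendsto_sum_qChoose {τ : ℂ} (hτ : 0 < τ.im) {c : ℤ → ℂ} (hc : Summable fun κ => ‖c κ‖) :
    Tendsto (fun n : ℕ => ∑ κ ∈ Finset.Icc (-(n : ℤ)) n, qChoose τ (2 * n) (n + κ).toNat * c κ)
      atTop (𝓝 ((eulerProd τ)⁻¹ * ∑' κ, c κ)) := by
  obtain ⟨C, hC⟩ := exists_norm_qChoose_le hτ
  have hC0 : 0 ≤ C := (norm_nonneg _).trans (hC 0 0)
  have h := tendsto_tsum_of_dominated_convergence (𝓕 := atTop)
    (f := fun (n : ℕ) (κ : ℤ) => if κ ∈ Finset.Icc (-(n : ℤ)) n then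
      qChoose τ (2 * n) (n + κ).toNat * c κ else 0)
    (g := fun κ => (eulerProd τ)⁻¹ * c κ) (bound := fun κ => C * ‖c κ‖) (hc.mul_left C) ?_ ?_
  · rw [tsum_mul_left] at h
    refine h.congr fun n => ?_
    rw [tsum_eq_sum (s := Finset.Icc (-(n : ℤ)) n) (fun κ hκ => if_neg hκ)]
    exact Finset.sum_congr rfl fun κ hκ => if_pos hκ
  · intro κ
    have hE := eulerProd_ne_zero hτ
    -- For fixed `κ` the three factorials all tend to the Euler product `E`, so the binomial tends
    -- to `E / (E * E) = E⁻¹`.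
    have h1 : Tendsto (fun n : ℕ => qFact τ (n + n) /
        (qFact τ (n + κ).toNat * qFact τ (n - κ).toNat) * c κ) atTop
        (𝓝 (eulerProd τ / (eulerProd τ * eulerProd τ) * c κ)) := by
      refine ((Tendsto.div ((tendsto_qFact hτ).comp ?_) (((tendsto_qFact hτ).comp ?_).mul
        ((tendsto_qFact hτ).comp ?_)) (mul_ne_zero hE hE))).mul_const _
      · exact tendsto_atTop_mono (fun n => by simp) tendsto_id
      · refine tendsto_atTop_atTop.mpr fun b => ⟨b + κ.natAbs, fun a ha => ?_⟩
        omega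
      · refine tendsto_atTop_atTop.mpr fun b => ⟨b + κ.natAbs, fun a ha => ?_⟩
        omega
    rw [div_mul_cancel_left₀ hE] at h1
    refine h1.congr' ?_
    filter_upwards [eventually_ge_atTop κ.natAbs] with n hn
    rw [if_pos (by rw [Finset.mem_Icc]; omega)]
    have := qChoose_eq_div hτ (n - κ).toNat (n + κ).toNat
    rw [show (n - κ).toNat + (n + κ).toNat = 2 * n by omega] at this
    rw [this, two_mul]
  · refine Eventually.of_forall fun n κ => ?_
    split_ifs
    · rw [norm_mul]; gcongr; exact hC _ _
    · rw [norm_zero]; positivity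

lemma summable_triple_term {τ : ℂ} (hτ : 0 < τ.im) {t : ℂ} (ht : t ≠ 0) :
    Summable fun κ : ℤ => ‖(-1) ^ κ * qpow τ (κ * (κ + 1) / 2) * t ^ κ‖ := by
  have hπ := Real.pi_pos
  refine (summable_exp_quadratic (a := Real.pi * τ.im) (by positivity)
    (-(Real.pi * τ.im) + Real.log ‖t‖) 0).congr fun n => ?_
  rw [norm_mul, norm_mul, norm_neg_one_zpow, one_mul, norm_qpow, norm_zpow,
    ← Real.rpow_intCast, Real.rpow_def_of_pos (norm_pos_iff.mpr ht), ← Real.exp_add]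
  ring_nf

/-- A consequence of the triple product: the theta series vanishes only where a factor does. -/
lemma tsum_triple_ne_zero {τ : ℂ} (hτ : 0 < τ.im) {t : ℂ} (ht : t ≠ 0)
    (h1 : ∀ i : ℕ, t * qpow τ (i + 1) ≠ 1) (h2 : ∀ i : ℕ, t⁻¹ * qpow τ i ≠ 1) :
    ∑' κ : ℤ, (-1) ^ κ * qpow τ (κ * (κ + 1) / 2) * t ^ κ ≠ 0 := by
  have hq := norm_qpow_one_lt hτ
  have lim := tendsto_sum_qChoose hτ (summable_triple_term hτ ht)
  have e1 : ∀ i : ℕ, t * qpow τ (i + 1) = (t * qpow τ 1) * qpow τ 1 ^ i := by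
    intro i; rw [qpow_add, qpow_natCast]; ring
  simp only [e1] at h1
  simp only [qpow_natCast] at h2
  have lim2 := (multipliable_one_sub_mul_geometric hq (t * qpow τ 1)).hasProd.tendsto_prod_nat.mul
    (multipliable_one_sub_mul_geometric hq t⁻¹).hasProd.tendsto_prod_nat
  have lim3 := lim.congr fun n => (finite_triple_product τ n ht).symm
  simp only [e1, qpow_natCast] at lim3
  have := tendsto_nhds_unique lim2 lim3
  intro h0
  rw [h0, mul_zero] at this
  exact mul_ne_zero
    (tprod_one_sub_mul_geometric_ne_zero hq fun i => sub_ne_zero.mpr (h1 i).symm)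
    (tprod_one_sub_mul_geometric_ne_zero hq fun i => sub_ne_zero.mpr (h2 i).symm) this

/-- The derivative at `t = 1` of the finite triple product. -/
lemma finite_jacobi (τ : ℂ) (n : ℕ) :
    ∑ κ ∈ Finset.Icc (-((n + 1 : ℕ) : ℤ)) (n + 1 : ℕ),
      qChoose τ (2 * (n + 1)) (((n + 1 : ℕ) : ℤ) + κ).toNat *
        ((-1) ^ κ * qpow τ (κ * (κ + 1) / 2) * κ) = qFact τ (n + 1) * qFact τ n := by
  -- The product without its factor `1 - t⁻¹`. That factor has a simple zero at `t = 1` with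
  -- derivative one, so the derivative of the whole product there is `R 1`.
  set R : ℂ → ℂ := fun t => (∏ i ∈ Finset.range (n + 1), (1 - t * qpow τ (i + 1))) *
    ∏ i ∈ Finset.range n, (1 - t⁻¹ * qpow τ ((i + 1 : ℕ) : ℝ)) with hR
  have hRd : DifferentiableAt ℂ R 1 := by
    rw [hR]
    have hi : DifferentiableAt ℂ (fun t : ℂ => t⁻¹) 1 := differentiableAt_inv one_ne_zero
    refine DifferentiableAt.mul ?_ ?_
    · fun_prop
    · refine DifferentiableAt.fun_finsetProd fun i _ => ?_
      exact (hi.mul_const _).const_sub _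
  have h1 : HasDerivAt (fun t : ℂ => (1 - t⁻¹) * R t) (R 1) 1 := by
    have hi : HasDerivAt (fun t : ℂ => 1 - t⁻¹) 1 1 := by
      simpa using (hasDerivAt_inv (one_ne_zero (α := ℂ))).const_sub 1
    simpa using hi.fun_mul hRd.hasDerivAt
  have h2 : HasDerivAt (fun t : ℂ => ∑ κ ∈ Finset.Icc (-((n + 1 : ℕ) : ℤ)) (n + 1 : ℕ),
      qChoose τ (2 * (n + 1)) (((n + 1 : ℕ) : ℤ) + κ).toNat *
        ((-1) ^ κ * qpow τ (κ * (κ + 1) / 2) * t ^ κ))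
      (∑ κ ∈ Finset.Icc (-((n + 1 : ℕ) : ℤ)) (n + 1 : ℕ),
      qChoose τ (2 * (n + 1)) (((n + 1 : ℕ) : ℤ) + κ).toNat *
        ((-1) ^ κ * qpow τ (κ * (κ + 1) / 2) * κ)) 1 := by
    refine HasDerivAt.fun_sum fun κ _ => ?_
    have := (hasDerivAt_zpow κ (1 : ℂ) (Or.inl one_ne_zero)).const_mul
      ((-1) ^ κ * qpow τ (κ * (κ + 1) / 2))
    simp only [one_zpow, mul_one] at this
    exact this.const_mul _
  have h3 : (fun t : ℂ => ∑ κ ∈ Finset.Icc (-((n + 1 : ℕ) : ℤ)) (n + 1 : ℕ),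
      qChoose τ (2 * (n + 1)) (((n + 1 : ℕ) : ℤ) + κ).toNat *
        ((-1) ^ κ * qpow τ (κ * (κ + 1) / 2) * t ^ κ)) =ᶠ[𝓝 1] fun t => (1 - t⁻¹) * R t := by
    filter_upwards [isOpen_ne.mem_nhds (one_ne_zero (α := ℂ))] with t ht
    rw [← finite_triple_product τ (n + 1) ht, Finset.prod_range_succ' (fun i : ℕ => 1 - t⁻¹ * qpow τ i)]
    simp [hR]
    ring
  rw [h2.unique (h1.congr_of_eventuallyEq h3)]
  simp only [hR, qFact, one_mul, inv_one]
  congr 1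
  · refine Finset.prod_congr rfl fun i _ => ?_
    rw [← qpow_natCast]; push_cast; rfl
  · refine Finset.prod_congr rfl fun i _ => ?_
    rw [qpow_natCast]

lemma summable_jacobi_term {τ : ℂ} (hτ : 0 < τ.im) :
    Summable fun κ : ℤ => ‖(-1) ^ κ * qpow τ (κ * (κ + 1) / 2) * (κ : ℂ)‖ := by
  have hπ := Real.pi_pos
  refine (summable_abs_mul_exp_quadratic (a := Real.pi * τ.im) (by positivity)
    (-(Real.pi * τ.im)) 0).congr fun n => ?_
  rw [norm_mul, norm_mul, norm_neg_one_zpow, one_mul, norm_qpow, mul_comm]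
  congr 1
  · congr 1; ring
  · simp

/-- Jacobi's identity for the cube of the Euler product. -/
lemma tsum_jacobi {τ : ℂ} (hτ : 0 < τ.im) :
    ∑' κ : ℤ, (-1) ^ κ * qpow τ (κ * (κ + 1) / 2) * (κ : ℂ) = eulerProd τ ^ 3 := by
  have lim := (tendsto_add_atTop_iff_nat 1).mpr (tendsto_sum_qChoose hτ (summable_jacobi_term hτ))
  have lim2 := (((tendsto_add_atTop_iff_nat 1).mpr (tendsto_qFact hτ)).mul (tendsto_qFact hτ))
  have := tendsto_nhds_unique (lim.congr fun n => finite_jacobi τ n) lim2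
  have hE := eulerProd_ne_zero hτ
  field_simp at this
  rw [this]

lemma eta_pow_three (τ : ℂ) : ModularForm.eta τ ^ 3 = qpow τ (1 / 8) * eulerProd τ ^ 3 := by
  have h1 : Function.Periodic.qParam 24 τ ^ 3 = qpow τ (1 / 8) := by
    rw [Function.Periodic.qParam, qpow, ← Complex.exp_nat_mul]
    congr 1; push_cast; ring
  have h2 : ∏' n, (1 - ModularForm.eta_q n τ) = eulerProd τ := by
    refine tprod_congr fun n => ?_
    rw [ModularForm.eta_q_eq_pow, qpow]; simp
  rw [ModularForm.eta, mul_pow, h1, h2]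

/-! ### Signed sums over opposite cones -/

/-- No summability is needed: reindexing by an equivalence and negation commute with `tsum`
unconditionally. -/
lemma tsum_eq_zero_of_comp_equiv_eq_neg {ι : Type*} {f : ι → ℂ} (σ : ι ≃ ι)
    (h : ∀ x, f (σ x) = -f x) : ∑' x, f x = 0 := by
  have h1 := σ.tsum_eq f
  rw [tsum_congr h, tsum_neg] at h1
  linear_combination (-1 / 2) * h1

lemma neg_one_zpow_eq_neg {a b : ℤ} (c : ℤ) (h : a = b + (2 * c + 1)) :
    (-1 : ℂ) ^ a = -(-1) ^ b := by
  rw [h, zpow_add₀ (by norm_num), zpow_add₀ (by norm_num), zpow_mul]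
  simp

lemma neg_one_zpow_eq {a b : ℤ} (c : ℤ) (h : a = b + 2 * c) : (-1 : ℂ) ^ a = (-1) ^ b := by
  rw [h, zpow_add₀ (by norm_num), zpow_mul]
  simp

/-- The reflection `n ↦ c - n` of the integers. -/
def reflect (c : ℤ) : ℤ ≃ ℤ := Equiv.subLeft c

@[simp] lemma reflect_apply (c n : ℤ) : reflect c n = c - n := rfl

/-- The function equal to `1` on the cone `α ≤ j, l ≤ β`, to `-1` on the opposite cone
`j < α, β < l`, and to `0` elsewhere. -/
def coneWeight (α β : ℤ) (x : ℤ × ℤ) : ℂ :=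
  (if α ≤ x.1 then 1 else 0) + (if x.2 ≤ β then 1 else 0) - 1

/-- The sum of `f` over the cone `α ≤ j, l ≤ β` minus the sum over the opposite cone. -/
def coneSum (α β : ℤ) (f : ℤ × ℤ → ℂ) : ℂ := ∑' x, coneWeight α β x * f x

lemma norm_coneWeight_le (α β : ℤ) (x : ℤ × ℤ) : ‖coneWeight α β x‖ ≤ 1 := by
  unfold coneWeight; split_ifs <;> simp

/-- This sign is what makes the indefinite exponent grow on the two cones; all convergence of the
double series rests on it. -/
lemma coneWeight_ne_zero {α β : ℤ} {x : ℤ × ℤ} (h : coneWeight α β x ≠ 0) :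
    (x.1 - α) * (x.2 - β) ≤ 0 := by
  unfold coneWeight at h
  split_ifs at h with h1 h2 h2
  · exact mul_nonpos_of_nonneg_of_nonpos (by omega) (by omega)
  · simp at h
  · simp at h
  · exact mul_nonpos_of_nonpos_of_nonneg (by omega) (by omega)

/-- The two weights differ exactly by the indicator of the row `l = β + 1`. -/
lemma coneSum_add_one_right {α β : ℤ} {f : ℤ × ℤ → ℂ}
    (h1 : Summable fun x => coneWeight α (β + 1) x * f x)
    (h0 : Summable fun x => coneWeight α β x * f x) :
    coneSum α (β + 1) f = coneSum α β f + ∑' j, f (j, β + 1) := by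
  rw [← sub_eq_iff_eq_add', coneSum, coneSum, ← h1.tsum_sub h0,
    ← Function.Injective.tsum_eq (g := fun j : ℤ => (j, β + 1)) (fun a b h => by simpa using h)]
  · refine tsum_congr fun j => ?_
    simp [coneWeight]
    split_ifs <;> ring
  · intro x hx
    simp only [Function.mem_support, ← sub_mul, coneWeight] at hx
    have hx := left_ne_zero_of_mul hx
    refine ⟨x.1, Prod.ext rfl ?_⟩
    by_contra hne
    have : x.2 ≤ β + 1 ↔ x.2 ≤ β := by
      have : x.2 ≠ β + 1 := fun h => hne h.symm
      omega
    simp [this] at hx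

/-- The two weights differ exactly by the indicator of the column `j = α`. -/
lemma coneSum_add_one_left {α β : ℤ} {f : ℤ × ℤ → ℂ}
    (h1 : Summable fun x => coneWeight (α + 1) β x * f x)
    (h0 : Summable fun x => coneWeight α β x * f x) :
    coneSum (α + 1) β f = coneSum α β f - ∑' l, f (α, l) := by
  rw [eq_sub_iff_add_eq, ← eq_sub_iff_add_eq', coneSum, coneSum, ← h0.tsum_sub h1,
    ← Function.Injective.tsum_eq (g := fun l : ℤ => (α, l)) (fun a b h => by simpa using h)]
  · refine tsum_congr fun j => ?_
    simp [coneWeight]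
    split_ifs <;> ring
  · intro x hx
    simp only [Function.mem_support, ← sub_mul, coneWeight] at hx
    have hx := left_ne_zero_of_mul hx
    refine ⟨x.2, Prod.ext ?_ rfl⟩
    by_contra hne
    have : α + 1 ≤ x.1 ↔ α ≤ x.1 := by
      have : x.1 ≠ α := fun h => hne h.symm
      omega
    simp [this] at hx

/-- The general term of the double series for the Laurent coefficients of a theta series of
index `m + 1/2` divided by the one of index `1/2`. -/
def quotTerm (m : ℕ) (e N : ℤ) (τ : ℂ) (x : ℤ × ℤ) : ℂ :=
  (-1) ^ (x.1 + x.2) * qpow τ (half x.1 ^ 2 / 2 + ((2 * m + 1) * x.2 + e) ^ 2 / (4 * m + 2) +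
    (N - ((2 * m + 1) * x.2 + e)) * half x.1)

lemma summable_coneWeight_mul_quotTerm (m : ℕ) (e N α β : ℤ) {τ : ℂ} (hτ : 0 < τ.im) :
    Summable fun x => ‖coneWeight α β x * quotTerm m e N τ x‖ := by
  have hy : 0 < 2 * Real.pi * τ.im := by have := Real.pi_pos; positivity
  set y := 2 * Real.pi * τ.im with hydef
  have hM : (0 : ℝ) < 2 * m + 1 := by positivity
  -- On the cones `j l ≤ α l + β j - α β`. Replacing the cross term by this linear bound splits the
  -- exponent into Gaussians in `j` and in `l`, whose coefficients are those of `s1` and `s2`.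
  have s1 := summable_exp_quadratic (a := y / 2) (by positivity)
    (-y * (1 / 2 + (N - e) - (2 * m + 1) * β))
    (-y * (1 / 8 + (N - e) / 2 + (2 * m + 1) * (α * β)))
  have s2 := summable_exp_quadratic (a := y * (2 * m + 1) / 2) (by positivity)
    (-y * (e - (2 * m + 1) * (α + 1 / 2))) (-y * (e ^ 2 / (4 * m + 2)))
  refine Summable.of_nonneg_of_le (fun x => norm_nonneg _) (fun x => ?_)
    (s1.mul_of_nonneg s2 (fun _ => (Real.exp_pos _).le) (fun _ => (Real.exp_pos _).le))
  by_cases h : coneWeight α β x = 0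
  · rw [h, zero_mul, norm_zero]; positivity
  · have hx : ((x.1 : ℝ) - α) * (x.2 - β) ≤ 0 := by exact_mod_cast coneWeight_ne_zero h
    rw [norm_mul, quotTerm, norm_mul, norm_neg_one_zpow, one_mul, norm_qpow, ← hydef,
      ← Real.exp_add]
    refine (mul_le_of_le_one_left (Real.exp_pos _).le (norm_coneWeight_le _ _ _)).trans ?_
    rw [Real.exp_le_exp, half]
    have e1 : ((2 * m + 1) * (x.2 : ℝ) + e) ^ 2 / (4 * m + 2) =
        (2 * m + 1) / 2 * x.2 ^ 2 + e * x.2 + e ^ 2 / (4 * m + 2) := by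
      field_simp; ring
    rw [e1]
    have key : 0 ≤ y * ((2 * m + 1) * (-(((x.1 : ℝ) - α) * (x.2 - β)))) := by
      have : 0 ≤ -(((x.1 : ℝ) - α) * (x.2 - β)) := by linarith
      positivity
    linarith

/-- With `c = N - ((2m+1) l + e)` the exponent depends on `j` only through `(half j + c)²`. The
reflection `half j + c ↦ -(half j + c)` changes the parity of `j`, so the terms cancel in pairs. -/
lemma tsum_quotTerm_row (m : ℕ) (e N l : ℤ) (τ : ℂ) : ∑' j, quotTerm m e N τ (j, l) = 0 := by
  refine tsum_eq_zero_of_comp_equiv_eq_neg (reflect (-1 - 2 * (N - ((2 * m + 1) * l + e)))) ?_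
  intro j
  simp only [quotTerm, reflect_apply, half]
  rw [← neg_mul]
  congr 1
  · exact neg_one_zpow_eq_neg (-(N - ((2 * m + 1) * l + e)) - j - 1) (by ring)
  · congr 1; push_cast; ring

/-- The Laurent coefficients of the quotient, see `quotTerm`. -/
def quotCoeff (m : ℕ) (e N : ℤ) (τ : ℂ) : ℂ := coneSum 0 0 (quotTerm m e N τ)

lemma coneSum_quotTerm_eq (m : ℕ) (e N α β β' : ℤ) {τ : ℂ} (hτ : 0 < τ.im) :
    coneSum α β (quotTerm m e N τ) = coneSum α β' (quotTerm m e N τ) := by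
  have step : ∀ β, coneSum α (β + 1) (quotTerm m e N τ) = coneSum α β (quotTerm m e N τ) := by
    intro β
    rw [coneSum_add_one_right (summable_coneWeight_mul_quotTerm m e N _ _ hτ).of_norm
      (summable_coneWeight_mul_quotTerm m e N _ _ hτ).of_norm, tsum_quotTerm_row, add_zero]
  have : ∀ β, coneSum α β (quotTerm m e N τ) = coneSum α 0 (quotTerm m e N τ) := by
    intro β
    induction β using Int.induction_on with
    | zero => rfl
    | succ i ih => rw [step, ih]
    | pred i ih => rw [← ih, ← step, sub_add_cancel]
  rw [this β, this β']

/-- The sum of `quotTerm` over a column. -/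
def quotCol (m : ℕ) (e N i : ℤ) (τ : ℂ) : ℂ := ∑' l, quotTerm m e N τ (i, l)

lemma coneSum_quotTerm_add (m : ℕ) (e N α β : ℤ) (n : ℕ) {τ : ℂ} (hτ : 0 < τ.im) :
    coneSum (α + n) β (quotTerm m e N τ) =
      coneSum α β (quotTerm m e N τ) - ∑ i ∈ Finset.range n, quotCol m e N (α + i) τ := by
  induction n with
  | zero => simp
  | succ n ih =>
    rw [Nat.cast_succ, ← add_assoc, coneSum_add_one_left
      (summable_coneWeight_mul_quotTerm m e N _ _ hτ).of_norm
      (summable_coneWeight_mul_quotTerm m e N _ _ hτ).of_norm, ih, Finset.sum_range_succ, quotCol]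
    ring

/-- The factor does not depend on `j` or `l`; this shift symmetry is the source of the
quasi-periodicity in `N`. -/
lemma quotTerm_shift (m : ℕ) (e N j l : ℤ) (τ : ℂ) :
    quotTerm m e (N + 2 * m) τ (j + 1, l + 1) = qpow τ (N + m) * quotTerm m e N τ (j, l) := by
  simp only [quotTerm]
  rw [mul_left_comm, ← qpow_add]
  congr 1
  · exact neg_one_zpow_eq 1 (by ring)
  · congr 1
    have hM : (2 * m + 1 : ℝ) ≠ 0 := by positivity
    have hM' : (4 * m + 2 : ℝ) ≠ 0 := by positivity
    simp only [half]; push_cast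
    field_simp
    ring

/-- The shift moves the vertex from `(0, 0)` to `(-1, -1)`. Returning is free in `l` and costs the
single column `j = -1`. -/
lemma quotCoeff_add_two_mul (m : ℕ) (e N : ℤ) {τ : ℂ} (hτ : 0 < τ.im) :
    quotCoeff m e (N + 2 * m) τ = qpow τ (N + m) * (quotCoeff m e N τ + quotCol m e N (-1) τ) := by
  have h := coneSum_quotTerm_add m e N (-1) 0 1 hτ
  simp only [Nat.cast_one, neg_add_cancel, Finset.sum_range_one, Nat.cast_zero, add_zero] at h
  rw [quotCoeff, quotCoeff, h, sub_add_cancel, coneSum_quotTerm_eq m e N (-1) 0 (-1) hτ, coneSum,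
    coneSum, ← (Equiv.addRight ((1, 1) : ℤ × ℤ)).tsum_eq, ← tsum_mul_left]
  refine tsum_congr fun x => ?_
  have hw : coneWeight 0 0 (x + (1, 1)) = coneWeight (-1) (-1) x := by
    have h1 : 0 ≤ x.1 + 1 ↔ -1 ≤ x.1 := by omega
    have h2 : x.2 + 1 ≤ 0 ↔ x.2 ≤ -1 := by omega
    simp only [coneWeight, Prod.fst_add, Prod.snd_add, h1, h2]
  have hq := quotTerm_shift m e N x.1 x.2 τ
  simp only [Equiv.coe_addRight, hw]
  rw [show x + (1, 1) = (x.1 + 1, x.2 + 1) from rfl, hq]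
  ring

/-- On the column `half j = -1/2` the exponent is invariant under `l ↦ -1 - l`, `e ↦ -e`, while the
sign changes. Hence the error terms for `e` and `-e` cancel. -/
lemma quotCol_neg_one (m : ℕ) (e N : ℤ) (τ : ℂ) :
    quotCol m (-e) N (-1) τ = -quotCol m e N (-1) τ := by
  rw [quotCol, quotCol, ← (reflect (-1)).tsum_eq, ← tsum_neg]
  refine tsum_congr fun l => ?_
  simp only [quotTerm, reflect_apply, half]
  rw [← neg_mul]
  congr 1
  · exact neg_one_zpow_eq_neg (-l - 1) (by ring)
  · congr 1
    have hM : (4 * m + 2 : ℝ) ≠ 0 := by positivity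
    push_cast
    field_simp
    ring

/-- The point reflection `(j, l) ↦ (-1 - j, -l)` swaps the opposite cones and also changes the sign
of the term. The vertex becomes `(0, -1)`, and its second coordinate is irrelevant. -/
lemma quotCoeff_neg (m : ℕ) (e N : ℤ) {τ : ℂ} (hτ : 0 < τ.im) :
    quotCoeff m e (-N) τ = quotCoeff m (-e) N τ := by
  rw [quotCoeff, quotCoeff, coneSum_quotTerm_eq m (-e) N 0 0 (-1) hτ, coneSum, coneSum,
    ← ((reflect (-1)).prodCongr (reflect 0)).tsum_eq]
  refine tsum_congr fun x => ?_
  have hw : coneWeight 0 0 (-1 - x.1, 0 - x.2) = -coneWeight 0 (-1) x := by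
    have h1 : 0 ≤ -1 - x.1 ↔ ¬ 0 ≤ x.1 := by omega
    have h2 : 0 - x.2 ≤ 0 ↔ ¬ x.2 ≤ -1 := by omega
    simp only [coneWeight, h1, h2]
    split_ifs <;> simp
  have hq : quotTerm m e (-N) τ (-1 - x.1, 0 - x.2) = -quotTerm m (-e) N τ x := by
    simp only [quotTerm, half]
    rw [← neg_mul]
    congr 1
    · exact neg_one_zpow_eq_neg (-x.1 - x.2 - 1) (by ring)
    · congr 1
      have hM : (4 * m + 2 : ℝ) ≠ 0 := by positivity
      push_cast
      field_simp
      ring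
  simp only [Equiv.prodCongr_apply, Prod.map, reflect_apply, hw, hq]
  ring

/-! ### The case of index zero and Jacobi's identity -/

lemma qpow_int_ne_one {τ : ℂ} (hτ : 0 < τ.im) {x : ℝ} (hx : x ≠ 0) : qpow τ x ≠ 1 := by
  intro h
  have := norm_qpow τ x
  rw [h, norm_one, eq_comm, Real.exp_eq_one_iff] at this
  have hπ := Real.pi_pos
  simp [hπ.ne', hτ.ne', hx] at this

/-- For `m = 0` the shift in `N` is by zero, and for `e = 0` the error column equals its own
negative. The recursion reads `c = q^N c`, with `q^N ≠ 1`. -/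
lemma quotCoeff_zero_of_ne_zero {τ : ℂ} (hτ : 0 < τ.im) {N : ℤ} (hN : N ≠ 0) :
    quotCoeff 0 0 N τ = 0 := by
  have h := quotCoeff_add_two_mul 0 0 N hτ
  have hc := quotCol_neg_one 0 0 N τ
  rw [neg_zero] at hc
  have hc0 : quotCol 0 0 N (-1) τ = 0 := by linear_combination (1 / 2) * hc
  simp only [Nat.cast_zero, mul_zero, add_zero, hc0] at h
  have h1 := qpow_int_ne_one hτ (x := N) (by exact_mod_cast hN)
  have h2 : (qpow τ N - 1) * quotCoeff 0 0 N τ = 0 := by linear_combination -h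
  exact (mul_eq_zero.mp h2).resolve_left (sub_ne_zero.mpr h1)

/-- A signed count: the diagonal meets one cone in `k + 1` points if `k ≥ 0`, the opposite one in
`-k - 1` points if `k < 0`. -/
lemma tsum_coneWeight_diag (k : ℤ) :
    ∑' j : ℤ, coneWeight 0 0 (j, j - k) = k + 1 := by
  have hw : ∀ j : ℤ, coneWeight 0 0 (j, j - k) =
      (if j ∈ Finset.Icc 0 k then 1 else 0) - if j ∈ Finset.Ioo k 0 then 1 else 0 := by
    intro j
    simp only [coneWeight, Finset.mem_Icc, Finset.mem_Ioo]
    have h2 : j - k ≤ 0 ↔ j ≤ k := by omega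
    simp only [h2]
    by_cases h3 : 0 ≤ j <;> by_cases h4 : j ≤ k
    · have : ¬ (k < j ∧ j < 0) := by omega
      simp [h3, h4, this]
    · have : ¬ k < j ∨ ¬ j < 0 := by omega
      simp [h3, h4]
    · simp [h3, h4]
    · have : k < j ∧ j < 0 := by omega
      simp [h3, h4, this]
  rw [tsum_congr hw, tsum_eq_sum (s := Finset.Icc 0 k ∪ Finset.Ioo k 0)
    (fun j hj => by simp only [Finset.mem_union, not_or] at hj; simp [hj.1, hj.2])]
  rw [Finset.sum_sub_distrib, Finset.sum_ite_mem, Finset.sum_ite_mem,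
    Finset.union_inter_cancel_left, Finset.union_inter_cancel_right]
  simp only [Finset.sum_const, Int.card_Icc, Int.card_Ioo, nsmul_eq_mul, mul_one]
  have : (((k + 1 - 0).toNat : ℤ) - ((0 - k - 1).toNat : ℤ)) = k + 1 := by omega
  exact_mod_cast this

/-- Here the exponent is `(half j - l)² / 2`, constant on diagonals `j - l = k`. Each diagonal
carries the factor `k + 1`: the part with `k` is Jacobi's series, the part with `1` cancels under `k
↦ -1 - k`. -/
lemma quotCoeff_zero {τ : ℂ} (hτ : 0 < τ.im) :
    quotCoeff 0 0 0 τ = ModularForm.eta τ ^ 3 := by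
  set σ : ℤ × ℤ ≃ ℤ × ℤ :=
    ⟨fun x => (x.2, x.2 - x.1), fun x => (x.1 - x.2, x.1), fun x => by simp, fun x => by simp⟩ with hσ
  have hs := σ.summable_iff.mpr (summable_coneWeight_mul_quotTerm 0 0 0 0 0 hτ).of_norm
  have hv : ∀ x : ℤ × ℤ, quotTerm 0 0 0 τ (σ x) =
      qpow τ (1 / 8) * ((-1) ^ x.1 * qpow τ (x.1 * (x.1 + 1) / 2)) := by
    intro x
    simp only [quotTerm, hσ, Equiv.coe_fn_mk, half]
    rw [mul_left_comm, ← qpow_add]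
    congr 1
    · exact neg_one_zpow_eq (x.2 - x.1) (by ring)
    · congr 1; push_cast; ring
  rw [quotCoeff, coneSum, ← σ.tsum_eq]
  refine hs.tsum_prod.trans ?_
  have h1 : ∀ k : ℤ, ∑' j : ℤ, ((fun x => coneWeight 0 0 x * quotTerm 0 0 0 τ x) ∘ σ) (k, j) =
      qpow τ (1 / 8) * ((-1) ^ k * qpow τ (k * (k + 1) / 2) * (k : ℂ) +
        (-1) ^ k * qpow τ (k * (k + 1) / 2) * 1 ^ k) := by
    intro k
    simp only [Function.comp_apply, hv]
    rw [tsum_mul_right]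
    have : ∀ j, coneWeight 0 0 (σ (k, j)) = coneWeight 0 0 (j, j - k) := fun j => rfl
    rw [tsum_congr this, tsum_coneWeight_diag]
    simp only [one_zpow]
    ring
  refine (tsum_congr h1).trans ?_
  have h0 : ∑' k : ℤ, (-1) ^ k * qpow τ (k * (k + 1) / 2) * (1 : ℂ) ^ k = 0 := by
    refine tsum_eq_zero_of_comp_equiv_eq_neg (reflect (-1)) fun k => ?_
    simp only [reflect_apply, one_zpow, mul_one]
    rw [← neg_mul]
    congr 1
    · exact neg_one_zpow_eq_neg (-k - 1) (by ring)
    · congr 1; push_cast; ring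
  rw [tsum_mul_left, (summable_jacobi_term hτ).of_norm.tsum_add
    (summable_triple_term hτ one_ne_zero).of_norm, h0, add_zero, tsum_jacobi hτ, eta_pow_three]

/-! ### The reciprocal theta series in the strip `|Im z| < Im τ` -/

/-- The general term of the Laurent expansion of `η³ / θ₀^{(-)}` (of index `1/2`). -/
def recipTerm (τ z : ℂ) (x : ℤ × ℤ) : ℂ :=
  coneWeight 0 0 (x.1, -x.2) *
    ((-1) ^ x.1 * qpow τ (half x.1 ^ 2 / 2 + x.2 * half x.1) * qpow z (x.2 / 2))

def recip (τ z : ℂ) : ℂ := ∑' x, recipTerm τ z x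

lemma summable_exp_neg_mul_abs {c : ℝ} (hc : 0 < c) :
    Summable fun l : ℤ => Real.exp (-c * |(l : ℝ)|) := by
  have h : Summable fun n : ℕ => Real.exp (-c * n) := by
    have := summable_geometric_of_lt_one (Real.exp_pos (-c)).le (Real.exp_lt_one_iff.mpr (by linarith) )
    refine this.congr fun n => ?_
    rw [← Real.exp_nat_mul, mul_comm]
  refine Summable.of_nat_of_neg ?_ ?_ <;> simpa using h

/-- On the cones `l · half j ≥ |l| / 2`, so `q^(l · half j)` is of size at most `exp (-π Im τ |l|)`.
This beats the growth `exp (π |Im z| |l|)` throughout the strip. -/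
lemma summable_recipTerm {τ z : ℂ} (hz : |z.im| < τ.im) :
    Summable fun x => ‖recipTerm τ z x‖ := by
  have hπ := Real.pi_pos
  have hτ : 0 < τ.im := (abs_nonneg _).trans_lt hz
  have s1 := summable_exp_quadratic (a := Real.pi * τ.im) (by positivity) (-(Real.pi * τ.im))
    (-(Real.pi * τ.im / 4))
  have s2 := summable_exp_neg_mul_abs (c := Real.pi * (τ.im - |z.im|))
    (mul_pos hπ (by linarith))
  refine Summable.of_nonneg_of_le (fun x => norm_nonneg _) (fun x => ?_)
    (s1.mul_of_nonneg s2 (fun _ => (Real.exp_pos _).le) (fun _ => (Real.exp_pos _).le))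
  by_cases h : coneWeight 0 0 (x.1, -x.2) = 0
  · rw [recipTerm, h, zero_mul, norm_zero]; positivity
  · have hx : |(x.2 : ℝ)| / 2 ≤ x.2 * half x.1 := by
      simp only [coneWeight] at h
      rw [half]
      split_ifs at h with h1 h2 h2
      · have a1 : (0 : ℝ) ≤ x.1 := by exact_mod_cast h1
        have a2 : (0 : ℝ) ≤ x.2 := by exact_mod_cast (by omega : 0 ≤ x.2)
        rw [abs_of_nonneg a2]
        nlinarith
      · simp at h
      · simp at h
      · have a1 : (x.1 : ℝ) ≤ -1 := by exact_mod_cast (by omega : x.1 ≤ -1)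
        have a2 : (x.2 : ℝ) ≤ 0 := by exact_mod_cast (by omega : x.2 ≤ 0)
        rw [abs_of_nonpos a2]
        nlinarith
    rw [recipTerm, norm_mul, norm_mul, norm_mul, norm_neg_one_zpow, one_mul, norm_qpow, norm_qpow,
      ← Real.exp_add, ← Real.exp_add]
    refine (mul_le_of_le_one_left (Real.exp_pos _).le (norm_coneWeight_le _ _ _)).trans ?_
    rw [Real.exp_le_exp]
    have h1 : -(z.im * x.2) ≤ |z.im| * |(x.2 : ℝ)| := by
      rw [← abs_mul]; exact neg_le_abs _
    have h2 := mul_le_mul_of_nonneg_left h1 hπ.le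
    have h3 := mul_le_mul_of_nonneg_left hx (by positivity : 0 ≤ 2 * Real.pi * τ.im)
    have h4 : half x.1 ^ 2 = x.1 ^ 2 + x.1 + 1 / 4 := by rw [half]; ring
    rw [h4]
    linarith

/-- Multiplying the reciprocal series with a theta series of index `m + 1/2`. -/
lemma hasSum_quotCoeff (m : ℕ) (e : ℤ) {τ z : ℂ} (hz : |z.im| < τ.im) :
    HasSum (fun N : ℤ => quotCoeff m e N τ * qpow z (N / 2))
      (recip τ z * theta (-1) e (m + 1 / 2) τ z) := by
  have hτ : 0 < τ.im := (abs_nonneg _).trans_lt hz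
  have h1 := summable_recipTerm hz
  have h2 := summable_theta_term_norm (ε := -1) (by simp) e (M := m + 1 / 2) (by positivity) hτ z
  rw [recip, theta_eq_tsum, tsum_mul_tsum_of_summable_norm h1 h2]
  have h3 := (summable_mul_of_summable_norm h1 h2).hasSum
  -- Terms of the triple series are grouped by the total exponent `N / 2` of `z`.
  set σ : ℤ × (ℤ × ℤ) ≃ (ℤ × ℤ) × ℤ :=
    ⟨fun x => ((x.2.1, x.1 - ((2 * m + 1) * x.2.2 + e)), x.2.2),
      fun x => (x.1.2 + ((2 * m + 1) * x.2 + e), (x.1.1, x.2)), fun x => by simp, fun x => by simp⟩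
    with hσ
  have h4 := σ.hasSum_iff.mpr h3
  have hterm : ∀ (N : ℤ) (x : ℤ × ℤ),
      (recipTerm τ z (σ (N, x)).1 * ((-1) ^ (σ (N, x)).2 *
        qpow τ ((m + 1 / 2) * ((σ (N, x)).2 + e / (2 * (m + 1 / 2))) ^ 2) *
        qpow z ((m + 1 / 2) * ((σ (N, x)).2 + e / (2 * (m + 1 / 2)))))) =
      (coneWeight 0 ((N - e) / (2 * m + 1)) x * quotTerm m e N τ x) * qpow z (N / 2) := by
    intro N x
    have hM : (2 * m + 1 : ℝ) ≠ 0 := by positivity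
    have hM' : (4 * m + 2 : ℝ) ≠ 0 := by positivity
    -- The condition on the eliminated index becomes a bound on `l` with a vertex depending on `N`;
    -- `coneSum_quotTerm_eq` later moves it back to `0`.
    have hw : coneWeight 0 0 (x.1, -(N - ((2 * m + 1) * x.2 + e))) =
        coneWeight 0 ((N - e) / (2 * m + 1)) x := by
      have : -(N - ((2 * m + 1) * x.2 + e)) ≤ 0 ↔ x.2 ≤ (N - e) / (2 * m + 1) := by
        rw [Int.le_ediv_iff_mul_le (by positivity), mul_comm x.2]
        constructor <;> intro h <;> linarith
      simp only [coneWeight, this]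
    simp only [hσ, Equiv.coe_fn_mk, recipTerm, hw, quotTerm]
    have e1 : qpow z (((N - ((2 * m + 1) * x.2 + e) : ℤ) : ℝ) / 2) *
        qpow z ((m + 1 / 2) * (x.2 + e / (2 * (m + 1 / 2)))) = qpow z (N / 2) := by
      rw [← qpow_add]; congr 1; push_cast; field_simp; ring
    have e2 : qpow τ (half x.1 ^ 2 / 2 + ((N - ((2 * m + 1) * x.2 + e) : ℤ) : ℝ) * half x.1) *
        qpow τ ((m + 1 / 2) * (x.2 + e / (2 * (m + 1 / 2))) ^ 2) =
        qpow τ (half x.1 ^ 2 / 2 + ((2 * m + 1) * x.2 + e) ^ 2 / (4 * m + 2) +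
          (N - ((2 * m + 1) * x.2 + e)) * half x.1) := by
      rw [← qpow_add]; congr 1; push_cast; field_simp; ring
    rw [← e1, ← e2, zpow_add₀ (by norm_num)]
    ring
  refine h4.prod_fiberwise fun N => ?_
  have h5 : HasSum (fun x => (coneWeight 0 ((N - e) / (2 * m + 1)) x * quotTerm m e N τ x) *
      qpow z (N / 2)) (quotCoeff m e N τ * qpow z (N / 2)) := by
    refine HasSum.mul_right _ ?_
    rw [quotCoeff, coneSum_quotTerm_eq m e N 0 0 ((N - e) / (2 * m + 1)) hτ]
    exact (summable_coneWeight_mul_quotTerm m e N _ _ hτ).of_norm.hasSum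
  exact h5.congr_fun (fun x => hterm N x)

lemma recip_mul_theta {τ z : ℂ} (hz : |z.im| < τ.im) :
    recip τ z * theta (-1) 0 (1 / 2) τ z = ModularForm.eta τ ^ 3 := by
  have hτ : 0 < τ.im := (abs_nonneg _).trans_lt hz
  have h := hasSum_quotCoeff 0 0 hz
  simp only [Nat.cast_zero, zero_add, Int.cast_zero] at h
  refine h.unique ?_
  have := hasSum_single (f := fun N : ℤ => quotCoeff 0 0 N τ * qpow z (N / 2)) 0
    (fun N hN => by simp [quotCoeff_zero_of_ne_zero hτ hN])
  simpa [quotCoeff_zero hτ] using this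

/-! ### Even periodic coefficients -/

lemma sum_range_neg_of_periodic {n : ℕ} {φ : ℤ → ℂ} (h : ∀ t, φ (t + n) = φ t) :
    ∑ t ∈ Finset.range n, φ (-(t : ℤ)) = ∑ t ∈ Finset.range n, φ t := by
  have h1 : ∑ t ∈ Finset.range n, φ ((t : ℤ) + 1) = ∑ t ∈ Finset.range n, φ t := by
    have a := Finset.sum_range_succ (fun t : ℕ => φ t) n
    have b := Finset.sum_range_succ' (fun t : ℕ => φ t) n
    have c := h 0
    rw [zero_add] at c
    simp only [Nat.cast_add, Nat.cast_one, Nat.cast_zero] at b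
    rw [b, c] at a
    exact add_right_cancel a
  rw [← h1, ← Finset.sum_range_reflect]
  refine Finset.sum_congr rfl fun t ht => ?_
  rw [← h (-_)]
  congr 1
  have := Finset.mem_range.mp ht
  omega

/-- Residues modulo `2m` pair under `t ↦ -t`, except the fixed points `0` and `m`, which are counted
once. -/
lemma sum_range_two_mul_of_even {m : ℕ} {φ : ℤ → ℂ} (h : ∀ t, φ (t + (2 * m : ℕ)) = φ t)
    (he : ∀ t, φ (-t) = φ t) :
    ∑ t ∈ Finset.range (2 * m), φ t = 2 * ∑ t ∈ Finset.range (m + 1), φ t - φ 0 - φ m := by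
  rw [two_mul m, Finset.sum_range_add]
  have h1 : ∑ t ∈ Finset.range m, φ ((m + t : ℕ) : ℤ) = ∑ t ∈ Finset.range m, φ ((t + 1 : ℕ) : ℤ) := by
    rw [← Finset.sum_range_reflect]
    refine Finset.sum_congr rfl fun t ht => ?_
    rw [← he, ← h]
    congr 1
    have := Finset.mem_range.mp ht
    omega
  have a := Finset.sum_range_succ (fun t : ℕ => φ t) m
  have b := Finset.sum_range_succ' (fun t : ℕ => φ t) m
  simp only [Nat.cast_zero] at b
  rw [h1]
  linear_combination -a - b

/-- The weight `1/2` at the end points `0` and `m`, and `1` in between. -/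
def endWeight (m k : ℕ) : ℂ := 1 - (if k = 0 then 1 / 2 else 0) - if k = m then 1 / 2 else 0

lemma sum_range_two_mul_eq_endWeight {m : ℕ} {φ : ℤ → ℂ}
    (h : ∀ t, φ (t + (2 * m : ℕ)) = φ t) (he : ∀ t, φ (-t) = φ t) :
    ∑ t ∈ Finset.range (2 * m), φ t = 2 * ∑ k : Fin (m + 1), endWeight m k * φ k := by
  rw [sum_range_two_mul_of_even h he,
    Fin.sum_univ_eq_sum_range (fun k : ℕ => endWeight m k * φ k) (m + 1)]
  simp only [endWeight, sub_mul, one_mul, Finset.sum_sub_distrib, ite_mul, zero_mul,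
    Finset.sum_ite_eq', Finset.mem_range]
  simp
  ring

lemma theta_one_add_period {m : ℕ} (hm : 0 < m) (t : ℤ) (τ z : ℂ) :
    theta 1 ((t + (2 * m : ℕ) : ℤ) : ℝ) m τ z = theta 1 t m τ z := by
  rw [theta_eq_tsum, theta_eq_tsum, ← (Equiv.addRight (1 : ℤ)).tsum_eq (fun n : ℤ =>
    (1 : ℂ) ^ n * qpow τ (m * (n + t / (2 * m)) ^ 2) * qpow z (m * (n + t / (2 * m))))]
  refine tsum_congr fun n => ?_
  have hm' : (m : ℝ) ≠ 0 := by positivity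
  have : (n : ℝ) + ((t + (2 * m : ℕ) : ℤ) : ℝ) / (2 * m) = (n + 1 : ℤ) + t / (2 * m) := by
    push_cast; field_simp; ring
  rw [this]
  simp

lemma theta_one_int_term {m : ℕ} (hm : 0 < m) (t n : ℤ) (τ z : ℂ) :
    (1 : ℂ) ^ n * qpow τ (m * (n + t / (2 * m)) ^ 2) * qpow z (m * (n + t / (2 * m))) =
      qpow τ ((t + 2 * m * n : ℤ) ^ 2 / (4 * m)) * qpow z ((t + 2 * m * n : ℤ) / 2) := by
  have hm' : (m : ℝ) ≠ 0 := by positivity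
  rw [one_zpow, one_mul]
  congr 2 <;> push_cast <;> field_simp <;> ring

lemma hasSum_theta_one {m : ℕ} (hm : 0 < m) (t : ℤ) {τ : ℂ} (hτ : 0 < τ.im) (z : ℂ) :
    HasSum (fun n : ℤ => qpow τ ((t + 2 * m * n : ℤ) ^ 2 / (4 * m)) *
      qpow z ((t + 2 * m * n : ℤ) / 2)) (theta 1 t m τ z) := by
  have h := (summable_theta_term_norm (ε := 1) (by simp) t (M := m) (by positivity) hτ z).of_norm.hasSum
  rw [← theta_eq_tsum] at h
  exact h.congr_fun fun n => (theta_one_int_term hm t n τ z).symm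

/-- A Laurent series with Gaussian coefficients twisted by a periodic sequence is a combination
of theta functions. -/
lemma hasSum_periodic_eq {m : ℕ} (hm : 0 < m) {τ : ℂ} (hτ : 0 < τ.im) {c : ℤ → ℂ} {S z : ℂ}
    (hc : ∀ t, c (t + (2 * m : ℕ)) = c t)
    (h : HasSum (fun N : ℤ => c N * (qpow τ (N ^ 2 / (4 * m)) * qpow z (N / 2))) S) :
    S = ∑ t ∈ Finset.range (2 * m), c t * theta 1 (t : ℤ) m τ z := by
  have hmod : ∀ (n t : ℤ), c (t + 2 * m * n) = c t := by
    intro n t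
    have hp : Function.Periodic c ((2 * m : ℕ) : ℤ) := hc
    have := hp.int_mul n t
    rw [← this]; congr 1; push_cast; ring
  have : NeZero (2 * m) := ⟨by omega⟩
  have h1 := ((Int.divModEquiv (2 * m)).symm.hasSum_iff.mpr h)
  have h2 := ((Equiv.prodComm (Fin (2 * m)) ℤ).hasSum_iff.mpr h1)
  have h3 := h2.prod_fiberwise (g := fun t : Fin (2 * m) => c (t : ℕ) * theta 1 ((t : ℕ) : ℤ) m τ z) ?_
  · rw [h3.unique (hasSum_fintype _)]
    exact Fin.sum_univ_eq_sum_range (fun t : ℕ => c t * theta 1 (t : ℤ) m τ z) (2 * m)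
  · intro t
    refine ((hasSum_theta_one hm ((t : ℕ) : ℤ) hτ z).mul_left (c (t : ℕ))).congr_fun fun n => ?_
    have e : (Int.divModEquiv (2 * m)).symm (n, t) = (t : ℕ) + 2 * m * n := by
      simp [Int.divModEquiv]; ring
    simp only [Function.comp_apply, Equiv.prodComm_apply, Prod.swap_prod_mk, e, hmod]

/-! ### The quotient of theta functions as a combination of theta functions -/

/-- The coefficient of `θ_{k,m}` in the quotient of theta functions. -/
def symCoeff (m p : ℕ) (τ : ℂ) (N : ℤ) : ℂ :=
  (quotCoeff m p N τ + quotCoeff m (-p) N τ) * qpow τ (-((N : ℝ) ^ 2 / (4 * m)))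

/-- The factor `q^(N+m)` of the quasi-periodicity is the quotient of consecutive Gaussians
`q^(N²/(4m))`, and the two error columns cancel. -/
lemma symCoeff_add {m : ℕ} (hm : 0 < m) (p : ℕ) {τ : ℂ} (hτ : 0 < τ.im) (N : ℤ) :
    symCoeff m p τ (N + (2 * m : ℕ)) = symCoeff m p τ N := by
  have hm' : (m : ℝ) ≠ 0 := by positivity
  rw [symCoeff, symCoeff]
  push_cast
  rw [quotCoeff_add_two_mul _ _ _ hτ, quotCoeff_add_two_mul _ _ _ hτ, quotCol_neg_one]
  have : qpow τ (-((N : ℝ) ^ 2 / (4 * m))) =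
      qpow τ (N + m) * qpow τ (-((N + 2 * m : ℝ) ^ 2 / (4 * m))) := by
    rw [← qpow_add]; congr 1; field_simp; ring
  rw [this]
  ring

lemma symCoeff_neg (m p : ℕ) {τ : ℂ} (hτ : 0 < τ.im) (N : ℤ) :
    symCoeff m p τ (-N) = symCoeff m p τ N := by
  rw [symCoeff, symCoeff, quotCoeff_neg _ _ _ hτ, quotCoeff_neg _ _ _ hτ, neg_neg]
  push_cast
  rw [neg_sq]
  ring

/-- Evenness of `c` allows replacing each theta function by the mean of those with indices `t` and
`-t`; then the sum over residues folds at `0` and `m`. -/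
lemma sum_range_theta_eq {m : ℕ} (hm : 0 < m) {c : ℤ → ℂ} (hc : ∀ t, c (t + (2 * m : ℕ)) = c t)
    (he : ∀ t, c (-t) = c t) (τ z : ℂ) :
    ∑ t ∈ Finset.range (2 * m), c t * theta 1 (t : ℤ) m τ z =
      ∑ k : Fin (m + 1), endWeight m k * c (k : ℕ) * thetaSym k m τ z := by
  have h1 := sum_range_neg_of_periodic (n := 2 * m) (φ := fun t => c t * theta 1 t m τ z)
    (fun t => by rw [hc, theta_one_add_period hm])
  have h2 := sum_range_two_mul_eq_endWeight (m := m)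
    (φ := fun t => c t * (theta 1 t m τ z + theta 1 (-t : ℤ) m τ z))
    (fun t => by
      rw [hc, theta_one_add_period hm, ← theta_one_add_period hm (-(t + (2 * m : ℕ)))]
      congr 5; push_cast; ring)
    (fun t => by rw [he, neg_neg, add_comm])
  simp only [mul_add, Finset.sum_add_distrib, he] at h1 h2
  rw [h1] at h2
  rw [← two_mul, ← mul_add] at h2
  have h3 := mul_left_cancel₀ (two_ne_zero (α := ℂ)) h2
  rw [h3, ← Finset.sum_add_distrib]
  refine Finset.sum_congr rfl fun k _ => ?_
  rw [thetaSym]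
  push_cast
  ring

lemma eta_mul_theta_of_mem_strip {m : ℕ} (hm : 0 < m) (p : ℕ) {τ z : ℂ} (hz : |z.im| < τ.im) :
    ModularForm.eta τ ^ 3 * (theta (-1) p (m + 1 / 2) τ z + theta (-1) (-p) (m + 1 / 2) τ z) =
      theta (-1) 0 (1 / 2) τ z *
        ∑ k : Fin (m + 1), endWeight m k * symCoeff m p τ (k : ℕ) * thetaSym k m τ z := by
  have hτ : 0 < τ.im := (abs_nonneg _).trans_lt hz
  have h := (hasSum_quotCoeff m p hz).add (hasSum_quotCoeff m (-p) hz)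
  have h2 : HasSum (fun N : ℤ => symCoeff m p τ N * (qpow τ (N ^ 2 / (4 * m)) * qpow z (N / 2)))
      (recip τ z * theta (-1) (p : ℤ) (m + 1 / 2) τ z +
        recip τ z * theta (-1) (-p : ℤ) (m + 1 / 2) τ z) := by
    refine h.congr_fun fun N => ?_
    rw [symCoeff, qpow_neg]
    field_simp [qpow_ne_zero]
  have h3 := hasSum_periodic_eq hm hτ (symCoeff_add hm p hτ) h2
  rw [sum_range_theta_eq hm (symCoeff_add hm p hτ) (symCoeff_neg m p hτ)] at h3
  rw [← h3, ← recip_mul_theta hz]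
  push_cast
  ring

lemma thetaSym_differentiable {m : ℕ} (hm : 0 < m) (k : ℕ) {τ : ℂ} (hτ : 0 < τ.im) :
    Differentiable ℂ (thetaSym k m τ) := by
  have hm' : (0 : ℝ) < m := by positivity
  exact (theta_differentiable k hm' hτ).add (theta_differentiable (-k) hm' hτ)

/-- Multiplied out, both sides are entire in `z`, so the identity theorem extends the equality from
the strip. -/
lemma eta_mul_theta {m : ℕ} (hm : 0 < m) (p : ℕ) {τ : ℂ} (hτ : 0 < τ.im) (z : ℂ) :
    ModularForm.eta τ ^ 3 * (theta (-1) p (m + 1 / 2) τ z + theta (-1) (-p) (m + 1 / 2) τ z) =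
      theta (-1) 0 (1 / 2) τ z *
        ∑ k : Fin (m + 1), endWeight m k * symCoeff m p τ (k : ℕ) * thetaSym k m τ z := by
  have d1 : ∀ a : ℤ, Differentiable ℂ (theta (-1) a (m + 1 / 2) τ) := by
    intro a
    have := theta_neg_one_differentiable a (2 * m + 1) ⟨m, rfl⟩ hτ
    rwa [show (((2 * m + 1 : ℕ) : ℝ) / 2) = m + 1 / 2 by push_cast; ring] at this
  have d2 : Differentiable ℂ (theta (-1) 0 (1 / 2) τ) := by
    simpa using theta_neg_one_differentiable 0 1 odd_one hτ
  have d3 : Differentiable ℂ fun z => ModularForm.eta τ ^ 3 *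
      (theta (-1) p (m + 1 / 2) τ z + theta (-1) (-p) (m + 1 / 2) τ z) := by
    have a := d1 p
    have b := d1 (-p)
    push_cast at a b
    exact (a.add b).const_mul _
  have d4 : Differentiable ℂ fun z => theta (-1) 0 (1 / 2) τ z *
      ∑ k : Fin (m + 1), endWeight m k * symCoeff m p τ (k : ℕ) * thetaSym k m τ z :=
    d2.mul (Differentiable.fun_sum fun k _ => (thetaSym_differentiable hm k hτ).const_mul _)
  have a3 : AnalyticOnNhd ℂ _ Set.univ := fun z _ => d3.analyticAt z
  have a4 : AnalyticOnNhd ℂ _ Set.univ := fun z _ => d4.analyticAt z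
  refine congrFun (a3.eq_of_eventuallyEq (z₀ := 0) a4 ?_) z
  have ho : IsOpen {z : ℂ | |z.im| < τ.im} :=
    isOpen_lt (continuous_abs.comp Complex.continuous_im) continuous_const
  filter_upwards [ho.mem_nhds (by simpa using hτ : (0 : ℂ) ∈ {z : ℂ | |z.im| < τ.im})] with z hz
  exact eta_mul_theta_of_mem_strip hm p hz

/-! ### Zeros of the denominator -/

lemma mem_lattice_of_qpow_mul_eq_one {τ z : ℂ} {a : ℤ}
    (h : qpow z (1 / 2) * qpow τ (a + 1 / 2) = 1) : z / 2 + τ / 2 ∈ lattice τ := by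
  rw [qpow, qpow, ← Complex.exp_add, Complex.exp_eq_one_iff] at h
  obtain ⟨n, hn⟩ := h
  refine ⟨n, -a, ?_⟩
  have hπ : (2 * Real.pi * I : ℂ) ≠ 0 := Complex.two_pi_I_ne_zero
  refine mul_left_cancel₀ hπ ?_
  push_cast at hn ⊢
  linear_combination hn

lemma theta_zero_half_ne_zero {τ z : ℂ} (hτ : 0 < τ.im) (hz : z ∈ domain2 τ) :
    theta (-1) 0 (1 / 2) τ z ≠ 0 := by
  -- For this `t` the theta series is the triple product series. A factor vanishes only if `qpow z
  -- (1/2) * q^(a + 1/2) = 1` with `a = i` or `a = -i - 1`, which puts `z / 2 + τ / 2` in the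
  -- lattice.
  set t := qpow z (1 / 2) * qpow τ (-(1 / 2)) with ht
  have ht0 : t ≠ 0 := mul_ne_zero (qpow_ne_zero _ _) (qpow_ne_zero _ _)
  have h := tsum_triple_ne_zero hτ ht0 ?_ ?_
  · convert h using 1
    rw [theta_eq_tsum]
    refine tsum_congr fun n => ?_
    rw [ht, mul_zpow, ← qpow_mul_int, ← qpow_mul_int, mul_assoc, mul_assoc, mul_left_comm (qpow τ _),
      ← qpow_add, mul_comm (qpow τ _)]
    congr 3 <;> ring
  · intro i hi
    apply hz.1
    refine mem_lattice_of_qpow_mul_eq_one (a := i) ?_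
    rw [← hi, ht, mul_assoc, ← qpow_add]
    congr 2; push_cast; ring
  · intro i hi
    apply hz.1
    refine mem_lattice_of_qpow_mul_eq_one (a := -i - 1) ?_
    rw [ht, mul_inv, ← qpow_neg, ← qpow_neg, mul_assoc, ← qpow_add, qpow_neg] at hi
    rw [← inv_inj, inv_one, ← hi, mul_inv, ← qpow_neg τ]
    congr 2; push_cast; ring

lemma Upsilon2_eq {m : ℕ} (hm : 0 < m) (p : ℕ) {τ z : ℂ} (hτ : 0 < τ.im) (hz : z ∈ domain2 τ) :
    Upsilon2 m p τ z =
      ∑ k : Fin (m + 1), endWeight m k * symCoeff m p τ (k : ℕ) * thetaSym k m τ z := by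
  rw [Upsilon2, ← mul_div_assoc, eta_mul_theta hm p hτ,
    mul_div_cancel_left₀ _ (theta_zero_half_ne_zero hτ hz)]

/-! ### The completed Appell function at `z₁ - z₂ = τ` -/

/-- The denominators tend to `1` as `j → ∞` and are unbounded as `j → -∞`, so all but finitely many
have norm at least `1/2`, and the numerators are Gaussian. -/
lemma summable_appell_term {m : ℕ} (hm : 0 < m) {τ : ℂ} (hτ : 0 < τ.im) (z : ℂ) :
    Summable fun j : ℤ => qpow z (m * j) * qpow τ (m * (j : ℝ) ^ 2) /
      (1 - qpow z (1 / 2) * qpow τ (j + 1 / 2)) := by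
  have hπ := Real.pi_pos
  have hs : Summable fun j : ℤ => 2 * ‖qpow z (m * j) * qpow τ (m * (j : ℝ) ^ 2)‖ := by
    refine ((summable_exp_quadratic (a := 2 * Real.pi * τ.im * m) (by positivity)
      (-(2 * Real.pi * z.im * m)) 0).mul_left 2).congr fun n => ?_
    rw [norm_mul, norm_qpow, norm_qpow, ← Real.exp_add]
    ring_nf
  refine Summable.of_norm_bounded_eventually hs ?_
  have hu : ∀ j : ℤ, ‖qpow z (1 / 2) * qpow τ (j + 1 / 2)‖ =
      Real.exp (-(2 * Real.pi * τ.im) * j + -(Real.pi * (z.im + τ.im))) := by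
    intro j
    rw [norm_mul, norm_qpow, norm_qpow, ← Real.exp_add]
    ring_nf
  have hneg : -(2 * Real.pi * τ.im) < 0 := by
    have : 0 < 2 * Real.pi * τ.im := by positivity
    linarith
  have key : ∀ᶠ j : ℤ in cofinite, 1 / 2 ≤ ‖1 - qpow z (1 / 2) * qpow τ (j + 1 / 2)‖ := by
    rw [Int.cofinite_eq, eventually_sup]
    constructor
    · have h1 : Tendsto (fun j : ℤ => ‖qpow z (1 / 2) * qpow τ (j + 1 / 2)‖) atBot atTop := by
        simp only [hu]
        refine Real.tendsto_exp_atTop.comp (tendsto_atTop_add_const_right _ _ ?_)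
        exact (tendsto_intCast_atBot_iff (R := ℝ) |>.mpr tendsto_id).const_mul_atBot_of_neg hneg
      filter_upwards [h1.eventually_ge_atTop 2] with j hj
      have := norm_sub_norm_le (qpow z (1 / 2) * qpow τ (j + 1 / 2)) 1
      rw [norm_sub_rev, norm_one] at this
      linarith
    · have h1 : Tendsto (fun j : ℤ => ‖qpow z (1 / 2) * qpow τ (j + 1 / 2)‖) atTop (𝓝 0) := by
        simp only [hu]
        refine Real.tendsto_exp_atBot.comp (tendsto_atBot_add_const_right _ _ ?_)
        exact (tendsto_intCast_atTop_atTop (R := ℝ)).const_mul_atTop_of_neg hneg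
      filter_upwards [h1.eventually_le_const (by norm_num : (0 : ℝ) < 1 / 2)] with j hj
      have := norm_sub_norm_le 1 (qpow z (1 / 2) * qpow τ (j + 1 / 2))
      rw [norm_one] at this
      linarith
  filter_upwards [key] with j hj
  rw [norm_div, div_le_iff₀ (by linarith)]
  nlinarith [norm_nonneg (qpow z (m * j) * qpow τ (m * (j : ℝ) ^ 2))]

lemma qpow_half_mul_ne_one {τ z : ℂ} (hz : z ∈ domain2 τ) (i : ℤ) :
    qpow z (1 / 2) * qpow τ (i + 1 / 2) ≠ 1 :=
  fun h => hz.1 (mem_lattice_of_qpow_mul_eq_one h)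

/-- The weight of `θ_{x,m}` in the expansions below. -/
def appellWeight (m : ℕ) (τ : ℂ) (x : ℝ) : ℂ := qpow τ (x / 2 - x ^ 2 / (4 * m))

lemma appellWeight_reflect {m : ℕ} (hm : 0 < m) (τ : ℂ) (x : ℝ) :
    appellWeight m τ (2 * m - x) = appellWeight m τ x := by
  have hm' : (m : ℝ) ≠ 0 := by positivity
  rw [appellWeight, appellWeight]
  congr 1
  field_simp
  ring

/-- Put `u = qpow z (1/2) * q^(i + 1/2)`. After `j ↦ -1 - j` in the second half, the two terms at
`i` are `A / (1 - u)` and `A u^(2m) / (1 - u⁻¹)`. Their sum is `A (1 + u + ⋯ + u^(2m))`, and the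
powers `u^t` give the theta series. -/
lemma PhiStar_eq {m : ℕ} (hm : 0 < m) {τ z : ℂ} (hτ : 0 < τ.im) (hz : z ∈ domain2 τ) :
    PhiStar m τ (z / 2 + τ / 2) (z / 2 - τ / 2) =
      ∑ t ∈ Finset.range (2 * m + 1), appellWeight m τ t * theta 1 (t : ℤ) m τ z := by
  have hm' : (m : ℝ) ≠ 0 := by positivity
  have s1 := summable_appell_term hm hτ z
  have s2 := summable_appell_term hm hτ (-z)
  have e1 : Phi1 m τ (z / 2 + τ / 2) (z / 2 - τ / 2) = ∑' j : ℤ,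
      qpow z (m * j) * qpow τ (m * (j : ℝ) ^ 2) /
      (1 - qpow z (1 / 2) * qpow τ (j + 1 / 2)) := by
    refine tsum_congr fun j => ?_
    congr 1
    · congr 1; rw [qpow]; congr 1; push_cast; ring
    · congr 1; simp only [qpow, ← Complex.exp_add]; congr 1; push_cast; ring
  have e2 : Phi2 m τ (z / 2 + τ / 2) (z / 2 - τ / 2) = ∑' j : ℤ,
      qpow (-z) (m * j) * qpow τ (m * (j : ℝ) ^ 2) /
      (1 - qpow (-z) (1 / 2) * qpow τ (j + 1 / 2)) := by
    refine tsum_congr fun j => ?_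
    congr 1
    · congr 1; rw [qpow]; congr 1; push_cast; ring
    · congr 1; simp only [qpow, ← Complex.exp_add]; congr 1; push_cast; ring
  have h1 := s1.hasSum.add ((reflect (-1)).hasSum_iff.mpr s2.hasSum)
  rw [← e1, ← e2] at h1
  have h2 : HasSum (fun i : ℤ => ∑ t ∈ Finset.range (2 * m + 1), appellWeight m τ t *
      (qpow τ (((t : ℤ) + 2 * m * i : ℤ) ^ 2 / (4 * m)) * qpow z (((t : ℤ) + 2 * m * i : ℤ) / 2)))
      (∑ t ∈ Finset.range (2 * m + 1), appellWeight m τ t * theta 1 (t : ℤ) m τ z) :=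
    hasSum_sum fun t _ => (hasSum_theta_one hm t hτ z).mul_left _
  refine h1.unique (h2.congr_fun fun i => ?_)
  set u := qpow z (1 / 2) * qpow τ (i + 1 / 2) with hu
  have hu1 : u ≠ 1 := qpow_half_mul_ne_one hz i
  have hu0 : u ≠ 0 := mul_ne_zero (qpow_ne_zero _ _) (qpow_ne_zero _ _)
  have hA : ∀ t : ℕ, appellWeight m τ t * (qpow τ (((t : ℤ) + 2 * m * i : ℤ) ^ 2 / (4 * m)) *
      qpow z (((t : ℤ) + 2 * m * i : ℤ) / 2)) =
      qpow z (m * i) * qpow τ (m * (i : ℝ) ^ 2) * u ^ t := by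
    intro t
    rw [hu, mul_pow, ← qpow_mul_nat, ← qpow_mul_nat, appellWeight, ← mul_assoc, ← qpow_add,
      mul_mul_mul_comm, ← qpow_add, ← qpow_add, mul_comm (qpow z _)]
    congr 2
    · push_cast; field_simp; ring
    · push_cast; ring
  have hB : qpow (-z) (m * ((-1 - i : ℤ) : ℝ)) * qpow τ (m * ((-1 - i : ℤ) : ℝ) ^ 2) =
      qpow z (m * i) * qpow τ (m * (i : ℝ) ^ 2) * u ^ (2 * m) := by
    rw [hu, mul_pow, ← qpow_mul_nat, ← qpow_mul_nat, mul_mul_mul_comm, ← qpow_add, ← qpow_add]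
    congr 1
    · simp only [qpow]; congr 1; push_cast; ring
    · congr 1; push_cast; ring
  have hC : qpow (-z) (1 / 2) * qpow τ (((-1 - i : ℤ) : ℝ) + 1 / 2) = u⁻¹ := by
    rw [hu, mul_inv, ← qpow_neg, ← qpow_neg]
    congr 1
    · simp only [qpow]; congr 1; push_cast; ring
    · congr 1; push_cast; ring
  rw [Finset.sum_congr rfl fun t _ => hA t, ← Finset.mul_sum, geom_sum_eq hu1]
  simp only [Function.comp_apply, reflect_apply, hB, hC]
  have h3 : (1 : ℂ) - u ≠ 0 := sub_ne_zero.mpr hu1.symm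
  have h4 : u - 1 ≠ 0 := sub_ne_zero.mpr hu1
  have h5 : (1 : ℂ) - u⁻¹ ≠ 0 := by
    rw [sub_ne_zero]; intro h; exact hu1 (by rw [← inv_inv u, ← h, inv_one])
  have h6 : (1 : ℂ) - u⁻¹ = (u - 1) / u := by field_simp
  rw [h6, ← neg_sub u 1]
  field_simp
  ring

/-! ### Zwegers' correction -/

lemma zwE_neg (x : ℝ) : zwE (-x) = -zwE x := by
  have h := intervalIntegral.integral_comp_neg (a := 0) (b := x)
    (fun u : ℝ => Real.exp (-Real.pi * u ^ 2))
  simp only [neg_sq, neg_zero] at h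
  rw [zwE, zwE, h, intervalIntegral.integral_symm]
  ring

/-- For `x > 0` the difference is twice the Gaussian tail beyond `x`. Shifting the tail to the
origin and dropping the cross term bounds it. -/
lemma abs_sign_sub_zwE_le (x : ℝ) : |Real.sign x - zwE x| ≤ Real.exp (-Real.pi * x ^ 2) := by
  have hπ := Real.pi_pos
  have hint : MeasureTheory.Integrable fun u : ℝ => Real.exp (-Real.pi * u ^ 2) :=
    integrable_exp_neg_mul_sq hπ
  have htot : ∫ u in Set.Ioi (0 : ℝ), Real.exp (-Real.pi * u ^ 2) = 1 / 2 := by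
    rw [integral_gaussian_Ioi, div_self hπ.ne', Real.sqrt_one]
  have pos : ∀ x : ℝ, 0 < x → |Real.sign x - zwE x| ≤ Real.exp (-Real.pi * x ^ 2) := by
    intro x hx
    have h1 := intervalIntegral.integral_interval_add_Ioi (a := 0) (b := x)
      (f := fun u : ℝ => Real.exp (-Real.pi * u ^ 2)) hint.integrableOn hint.integrableOn
    have h2 : ∫ u in Set.Ioi x, Real.exp (-Real.pi * u ^ 2) ≤ Real.exp (-Real.pi * x ^ 2) / 2 := by
      have h3 := (MeasureTheory.measurePreserving_add_right MeasureTheory.volume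
        x).setIntegral_preimage_emb (measurableEmbedding_addRight x)
        (fun u : ℝ => Real.exp (-Real.pi * u ^ 2)) (Set.Ioi x)
      rw [Set.preimage_add_const_Ioi, sub_self] at h3
      rw [← h3]
      calc ∫ u in Set.Ioi (0 : ℝ), Real.exp (-Real.pi * (u + x) ^ 2)
          ≤ ∫ u in Set.Ioi (0 : ℝ), Real.exp (-Real.pi * x ^ 2) * Real.exp (-Real.pi * u ^ 2) := by
            refine MeasureTheory.setIntegral_mono_on (hint.comp_add_right x).integrableOn
              (hint.const_mul _).integrableOn measurableSet_Ioi fun u hu => ?_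
            rw [← Real.exp_add, Real.exp_le_exp]
            have : 0 < Real.pi * (u * x) := mul_pos hπ (mul_pos hu hx)
            nlinarith
        _ = _ := by
            rw [MeasureTheory.integral_const_mul, htot]; ring
    have h4 : 0 ≤ ∫ u in Set.Ioi x, Real.exp (-Real.pi * u ^ 2) :=
      MeasureTheory.integral_nonneg fun u => (Real.exp_pos _).le
    rw [htot] at h1
    rw [Real.sign_of_pos hx, zwE, abs_of_nonneg (by linarith)]
    linarith
  rcases lt_trichotomy x 0 with h | h | h
  · have := pos (-x) (by linarith)
    rw [zwE_neg, Real.sign_neg, neg_sq, ← abs_neg] at this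
    convert this using 2
    ring
  · simp [h, zwE]
  · exact pos x h

lemma sign_mul_of_pos (x : ℝ) {c : ℝ} (hc : 0 < c) : Real.sign (x * c) = Real.sign x := by
  rcases lt_trichotomy x 0 with h | h | h
  · rw [Real.sign_of_neg h, Real.sign_of_neg (mul_neg_of_neg_of_pos h hc)]
  · rw [h, zero_mul]
  · rw [Real.sign_of_pos h, Real.sign_of_pos (mul_pos h hc)]

/-- The part of the general term of `zwR` that is odd under `n ↦ 2m - n`. -/
def zwOdd (m : ℕ) (τ : ℂ) (n : ℤ) : ℂ :=
  ((Real.sign (n - m) - zwE ((n - m) * Real.sqrt (τ.im / m)) : ℝ) : ℂ) * appellWeight m τ n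

lemma zwOdd_reflect {m : ℕ} (hm : 0 < m) (τ : ℂ) (n : ℤ) :
    zwOdd m τ (2 * m - n) = -zwOdd m τ n := by
  rw [zwOdd, zwOdd, show ((2 * m - n : ℤ) : ℝ) = 2 * m - n by push_cast; ring,
    appellWeight_reflect hm, show ((2 * m - n : ℝ) - m) = -(n - m) by ring, Real.sign_neg,
    neg_mul, zwE_neg]
  push_cast
  ring

/-- The error function decays with twice the quadratic rate at which `appellWeight` grows, so
Gaussian decay remains. -/
lemma summable_zwOdd {m : ℕ} (hm : 0 < m) {τ : ℂ} (hτ : 0 < τ.im) : Summable (zwOdd m τ) := by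
  have hπ := Real.pi_pos
  have hm' : (0 : ℝ) < m := by positivity
  refine Summable.of_norm_bounded (summable_exp_quadratic (a := Real.pi * τ.im / (2 * m))
    (by positivity) (Real.pi * τ.im) (-(Real.pi * τ.im * m))) fun n => ?_
  rw [zwOdd, norm_mul, appellWeight, norm_qpow, Complex.norm_real, Real.norm_eq_abs]
  have hc : 0 < Real.sqrt (τ.im / m) := Real.sqrt_pos.mpr (by positivity)
  have h := abs_sign_sub_zwE_le ((n - m) * Real.sqrt (τ.im / m))
  rw [sign_mul_of_pos _ hc, mul_pow, Real.sq_sqrt (by positivity)] at h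
  refine (mul_le_mul_of_nonneg_right h (Real.exp_pos _).le).trans ?_
  rw [← Real.exp_add, Real.exp_le_exp]
  refine le_of_eq ?_
  field_simp
  ring

/-- The odd part of `zwR`. -/
def zwROdd (m : ℕ) (τ : ℂ) (j : ℤ) : ℂ := ∑' l : ℤ, zwOdd m τ (j + 2 * m * l)

lemma zwROdd_add (m : ℕ) (τ : ℂ) (j : ℤ) : zwROdd m τ (j + (2 * m : ℕ)) = zwROdd m τ j := by
  rw [zwROdd, zwROdd, ← (Equiv.addRight (1 : ℤ)).tsum_eq (fun l => zwOdd m τ (j + 2 * m * l))]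
  refine tsum_congr fun l => ?_
  congr 1
  simp only [Equiv.coe_addRight]
  push_cast
  ring

lemma zwROdd_neg {m : ℕ} (hm : 0 < m) (τ : ℂ) (j : ℤ) : zwROdd m τ (-j) = -zwROdd m τ j := by
  rw [zwROdd, zwROdd, ← tsum_neg, ← (reflect 1).tsum_eq]
  refine tsum_congr fun l => ?_
  rw [← zwOdd_reflect hm]
  congr 1
  simp only [reflect_apply]
  ring

/-- At `v = τ / 2` the error function is centred at `n = m`. For `j < 2m` the sign in `zwR` is that
of `n - m` except possibly at `l = 0`, where it is `1`; this accounts for the second summand. -/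
lemma zwR_eq {m : ℕ} (hm : 0 < m) {τ : ℂ} (hτ : 0 < τ.im) {j : ℕ} (hj : j < 2 * m) :
    zwR j m τ (τ / 2) =
      zwROdd m τ j + (1 - Real.sign (j - m) : ℝ) * appellWeight m τ j := by
  have hm' : (m : ℝ) ≠ 0 := by positivity
  have hinj : Function.Injective fun l : ℤ => (j : ℤ) + 2 * m * l := by
    intro a b h
    simpa [hm.ne'] using h
  have h1 : HasSum (fun l : ℤ => zwOdd m τ (j + 2 * m * l)) (zwROdd m τ j) :=
    ((summable_zwOdd hm hτ).comp_injective hinj).hasSum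
  have h2 := h1.add (hasSum_ite_eq (0 : ℤ) (((1 - Real.sign (j - m) : ℝ) : ℂ) * appellWeight m τ j))
  rw [← h2.tsum_eq, zwR]
  refine tsum_congr fun l => ?_
  have hv : (τ / 2 : ℂ).im / τ.im = 1 / 2 := by
    have : (τ / 2 : ℂ).im = τ.im / 2 := by simp
    rw [this]; field_simp
  have hn : (j + 2 * m * l : ℝ) = ((j + 2 * m * l : ℤ) : ℝ) := by push_cast; ring
  have hexp : ∀ n : ℝ, cexp (-(Real.pi * I * (n : ℂ) ^ 2 * τ / (2 * m)) +
      2 * Real.pi * I * n * (τ / 2)) = appellWeight m τ n := by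
    intro n
    rw [appellWeight, qpow]
    congr 1
    have : (m : ℂ) ≠ 0 := by exact_mod_cast hm'
    push_cast
    field_simp
    ring
  simp only [hv, hexp]
  rw [show ((j + 2 * m * l : ℝ) - 1 / 2 - j + 2 * m) = (2 * m * (l + 1) - 1 / 2 : ℝ) by ring,
    show (j + 2 * m * l - 2 * m * (1 / 2) : ℝ) = (j + 2 * m * l : ℝ) - m by ring]
  rw [hn, zwOdd]
  set E := zwE ((((j + 2 * m * l : ℤ) : ℝ) - m) * Real.sqrt (τ.im / m))
  have hm1 : (1 : ℝ) ≤ m := by exact_mod_cast hm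
  have hj' : (j : ℝ) < 2 * m := by exact_mod_cast hj
  have hj0 : (0 : ℝ) ≤ j := by positivity
  rcases lt_trichotomy l 0 with h | h | h
  · have hl : (l : ℝ) ≤ -1 := by exact_mod_cast (by omega : l ≤ -1)
    rw [if_neg h.ne, Real.sign_of_neg (by nlinarith), Real.sign_of_neg (by push_cast; nlinarith),
      add_zero]
  · subst h
    rw [if_pos rfl, Real.sign_of_pos (by push_cast; linarith)]
    push_cast
    simp only [mul_zero, add_zero]
    ring
  · have hl : (1 : ℝ) ≤ l := by exact_mod_cast (by omega : 1 ≤ l)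
    rw [if_neg h.ne', Real.sign_of_pos (by nlinarith), Real.sign_of_pos (by push_cast; nlinarith),
      add_zero]

/-- An odd function of the residue times an even one sums to zero over all residues modulo `2m`. -/
lemma sum_zwROdd_mul_thetaSym {m : ℕ} (hm : 0 < m) (τ z : ℂ) :
    ∑ j ∈ Finset.range (2 * m), zwROdd m τ j * thetaSym j m τ z = 0 := by
  have h := sum_range_neg_of_periodic (n := 2 * m)
    (φ := fun t => zwROdd m τ t * (theta 1 t m τ z + theta 1 (-t : ℤ) m τ z)) fun t => by
      rw [zwROdd_add, theta_one_add_period hm, ← theta_one_add_period hm (-(t + (2 * m : ℕ)))]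
      congr 5; push_cast; ring
  simp only [zwROdd_neg hm, neg_neg, neg_mul, Finset.sum_neg_distrib] at h
  have h2 : ∑ j ∈ Finset.range (2 * m), zwROdd m τ j * thetaSym j m τ z =
      ∑ t ∈ Finset.range (2 * m),
        zwROdd m τ t * (theta 1 (t : ℤ) m τ z + theta 1 (-t : ℤ) m τ z) := by
    refine Finset.sum_congr rfl fun t _ => ?_
    rw [thetaSym]
    push_cast
    rfl
  rw [h2]
  have h3 : ∀ t : ℕ, theta 1 (-(t : ℤ) : ℤ) m τ z + theta 1 (t : ℤ) m τ z =
    theta 1 (t : ℤ) m τ z + theta 1 (-(t : ℤ) : ℤ) m τ z := fun t => add_comm _ _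
  simp only [h3] at h
  linear_combination (-1 / 2) * h

/-- The term `j = 2m` may be added since its factor is zero. Then `j ↦ 2m - j` turns the half with
index `-j` into one with factor `1 + sign`, and the two factors add up to `2`. -/
lemma sum_appellWeight_mul_thetaSym {m : ℕ} (hm : 0 < m) (τ z : ℂ) :
    ∑ j ∈ Finset.range (2 * m), ((1 - Real.sign (j - m) : ℝ) : ℂ) * appellWeight m τ j *
      thetaSym j m τ z =
      2 * ∑ t ∈ Finset.range (2 * m + 1), appellWeight m τ t * theta 1 (t : ℤ) m τ z := by
  have hm' : (0 : ℝ) < m := by positivity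
  have h0 : Real.sign (((2 * m : ℕ) : ℝ) - m) = 1 :=
    Real.sign_of_pos (by push_cast; linarith)
  have h1 := Finset.sum_range_succ (fun j : ℕ => ((1 - Real.sign (j - m) : ℝ) : ℂ) *
    appellWeight m τ j * thetaSym j m τ z) (2 * m)
  rw [h0, sub_self, Complex.ofReal_zero, zero_mul, zero_mul, add_zero] at h1
  rw [← h1]
  have h2 : ∑ j ∈ Finset.range (2 * m + 1), ((1 - Real.sign (j - m) : ℝ) : ℂ) *
      appellWeight m τ j * theta 1 (-j : ℤ) m τ z =
      ∑ j ∈ Finset.range (2 * m + 1), ((1 + Real.sign (j - m) : ℝ) : ℂ) *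
      appellWeight m τ j * theta 1 (j : ℤ) m τ z := by
    rw [← Finset.sum_range_reflect]
    refine Finset.sum_congr rfl fun j hj => ?_
    have hj' := Finset.mem_range.mp hj
    have e : 2 * m + 1 - 1 - j = 2 * m - j := by omega
    have e1 : ((2 * m - j : ℕ) : ℝ) = 2 * m - j := by
      rw [Nat.cast_sub (by omega)]; push_cast; ring
    rw [e, e1, appellWeight_reflect hm, show (2 * m - j - m : ℝ) = -(j - m) by ring, Real.sign_neg,
      ← theta_one_add_period hm (-((2 * m - j : ℕ) : ℤ))]
    congr 2
    · push_cast; ring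
    · congr 1; omega
  simp only [thetaSym, mul_add, Finset.sum_add_distrib]
  have h3 : ∀ j : ℕ, theta 1 (-(j : ℝ)) m τ z = theta 1 (-j : ℤ) m τ z := by
    intro j; push_cast; rfl
  simp only [h3]
  rw [h2, ← Finset.sum_add_distrib, Finset.mul_sum]
  refine Finset.sum_congr rfl fun j _ => ?_
  push_cast
  ring

lemma psi2_eq_zero {m : ℕ} (hm : 0 < m) {τ z : ℂ} (hτ : 0 < τ.im) (hz : z ∈ domain2 τ) :
    psi2 m τ z = 0 := by
  rw [psi2, PhiTilde, PhiStar_eq hm hτ hz, PhiAdd,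
    show (z / 2 + τ / 2 - (z / 2 - τ / 2)) / 2 = τ / 2 by ring,
    show z / 2 + τ / 2 + (z / 2 - τ / 2) = z by ring]
  have h : ∑ j ∈ Finset.range (2 * m), zwR j m τ (τ / 2) * thetaSym j m τ z =
      ∑ j ∈ Finset.range (2 * m), zwROdd m τ j * thetaSym j m τ z +
      ∑ j ∈ Finset.range (2 * m), ((1 - Real.sign (j - m) : ℝ) : ℂ) * appellWeight m τ j *
        thetaSym j m τ z := by
    rw [← Finset.sum_add_distrib]
    refine Finset.sum_congr rfl fun j hj => ?_
    rw [zwR_eq hm hτ (Finset.mem_range.mp hj), add_mul]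
  rw [h, sum_zwROdd_mul_thetaSym hm, sum_appellWeight_mul_thetaSym hm]
  ring

/-! ### The shift `z ↦ z + 1` -/

lemma thetaSym_add_one {m : ℕ} (hm : 0 < m) (k : ℕ) (τ z : ℂ) :
    thetaSym k m τ (z + 1) = (-1) ^ k * thetaSym k m τ z := by
  have h1 := theta_add_one 1 k (2 * m) (by omega) τ z
  have h2 := theta_add_one 1 (-k) (2 * m) (by omega) τ z
  have e : (((2 * m : ℕ) : ℝ) / 2) = m := by push_cast; ring
  rw [e] at h1 h2
  push_cast at h1 h2
  rw [thetaSym, thetaSym, h1, h2]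
  simp [zpow_neg, pow_mul]
  rw [← inv_pow]
  norm_num
  ring

lemma zwR_add_half (j m : ℕ) (τ v : ℂ) : zwR j m τ (v + 1 / 2) = (-1) ^ j * zwR j m τ v := by
  rw [zwR, zwR, ← tsum_mul_left]
  refine tsum_congr fun l => ?_
  have him : (v + 1 / 2).im = v.im := by simp
  have hexp : cexp (2 * Real.pi * I * ((j + 2 * m * l : ℝ) : ℂ) * (1 / 2)) = (-1) ^ j := by
    have := qpow_one_int_div_two (j + 2 * m * l)
    rw [neg_one_zpow_eq (m * l) (by ring : (j + 2 * m * l : ℤ) = j + 2 * (m * l)), zpow_natCast] at this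
    rw [← this, qpow]
    congr 1; push_cast; ring
  simp only [him, mul_add, Complex.exp_add, hexp]
  ring

/-- In the correction, the sign `(-1)^j` of `zwR` cancels that of `thetaSym`. -/
lemma PhiTilde_add_one {m : ℕ} (hm : 0 < m) (τ z₁ z₂ : ℂ) :
    PhiTilde m τ (z₁ + 1) z₂ = PhiTilde m τ z₁ z₂ := by
  have hint : ∀ n : ℤ, cexp (2 * Real.pi * I * n) = 1 := by
    intro n
    have := qpow_one_int n
    rw [← this, qpow]; congr 1; push_cast; ring
  have h1 : Phi1 m τ (z₁ + 1) z₂ = Phi1 m τ z₁ z₂ := by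
    refine tsum_congr fun j => ?_
    rw [show (2 * Real.pi * I * m * j * (z₁ + 1 + z₂) : ℂ) =
      2 * Real.pi * I * m * j * (z₁ + z₂) + 2 * Real.pi * I * (m * j : ℤ) by push_cast; ring,
      show (2 * Real.pi * I * (z₁ + 1) : ℂ) = 2 * Real.pi * I * z₁ + 2 * Real.pi * I * (1 : ℤ) by
        push_cast; ring, Complex.exp_add, Complex.exp_add, hint, hint, mul_one, mul_one]
  have h2 : Phi2 m τ (z₁ + 1) z₂ = Phi2 m τ z₁ z₂ := by
    refine tsum_congr fun j => ?_
    rw [show (-(2 * Real.pi * I * m * j * (z₁ + 1 + z₂)) : ℂ) =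
      -(2 * Real.pi * I * m * j * (z₁ + z₂)) + 2 * Real.pi * I * (-(m * j) : ℤ) by push_cast; ring,
      Complex.exp_add, hint, mul_one]
  have h3 : PhiAdd m τ (z₁ + 1) z₂ = PhiAdd m τ z₁ z₂ := by
    rw [PhiAdd, PhiAdd]
    congr 1
    refine Finset.sum_congr rfl fun j _ => ?_
    rw [show (z₁ + 1 - z₂) / 2 = (z₁ - z₂) / 2 + 1 / 2 by ring, zwR_add_half,
      show z₁ + 1 + z₂ = z₁ + z₂ + 1 by ring, thetaSym_add_one hm, mul_mul_mul_comm, ← mul_pow]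
    norm_num
  rw [PhiTilde, PhiTilde, PhiStar, PhiStar, h1, h2, h3]

lemma psi1_eq {m : ℕ} (hm : 0 < m) (τ z : ℂ) : psi1 m τ z = psi2 m τ (z + 1) := by
  rw [psi1, psi2, ← PhiTilde_add_one hm]
  congr 1 <;> ring

lemma Upsilon1_eq (m p : ℕ) (τ z : ℂ) :
    Upsilon1 m p τ z = (-1) ^ p * Upsilon2 m p τ (z + 1) := by
  have h1 := theta_add_one (-1) p (2 * m + 1) (by omega) τ z
  have h2 := theta_add_one (-1) (-p) (2 * m + 1) (by omega) τ z
  have h3 := theta_add_one (-1) 0 1 (by omega) τ z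
  rw [show (((2 * m + 1 : ℕ) : ℝ) / 2) = m + 1 / 2 by push_cast; ring] at h1 h2
  have e : (-1 : ℂ) * (-1) ^ (2 * m + 1) = 1 := by
    rw [← pow_succ']; exact Even.neg_one_pow ⟨m + 1, by ring⟩
  have e2 : (-1 : ℂ) ^ (-(p : ℤ)) = (-1) ^ p := by
    rw [neg_one_zpow_eq (-p) (by ring : (-(p : ℤ)) = p + 2 * (-p)), zpow_natCast]
  rw [e] at h1 h2
  rw [e2] at h2
  push_cast at h1 h2 h3
  rw [zpow_natCast] at h1
  simp only [zpow_zero, one_mul, pow_one, mul_neg, mul_one, neg_neg] at h3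
  rw [Upsilon1, Upsilon2, h1, h2, h3, ← mul_add, mul_div_assoc, mul_left_comm, ← mul_assoc,
    ← mul_assoc, mul_assoc (_ ^ 3), ← mul_pow]
  norm_num

lemma add_one_mem_domain2 {τ z : ℂ} (hz : z ∈ domain1 τ) : z + 1 ∈ domain2 τ := by
  refine ⟨fun ⟨a, b, h⟩ => hz.1 ⟨a - 1, b, ?_⟩, fun ⟨a, b, h⟩ => hz.2 ⟨a, b, ?_⟩⟩
  · push_cast; linear_combination h
  · linear_combination h

lemma sub_one_mem_domain1 {τ z : ℂ} (hz : z ∈ domain2 τ) : z - 1 ∈ domain1 τ := by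
  refine ⟨fun ⟨a, b, h⟩ => hz.1 ⟨a + 1, b, ?_⟩, fun ⟨a, b, h⟩ => hz.2 ⟨a, b, ?_⟩⟩
  · push_cast; linear_combination h
  · linear_combination h

lemma G2_eq {m : ℕ} (hm : 0 < m) (p : ℕ) {τ z : ℂ} (hτ : 0 < τ.im) (hz : z ∈ domain2 τ) :
    G2 m p τ z =
      ∑ k : Fin (m + 1), -(endWeight m k * symCoeff m p τ (k : ℕ)) * thetaSym k m τ z := by
  rw [G2, Xi2, psi2_eq_zero hm hτ hz, Upsilon2_eq hm p hτ hz]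
  simp only [neg_mul, Finset.sum_neg_distrib]
  ring

lemma G1_eq {m : ℕ} (hm : 0 < m) (p : ℕ) {τ z : ℂ} (hτ : 0 < τ.im) (hz : z ∈ domain1 τ) :
    G1 m p τ z = ∑ k : Fin (m + 1), -((-1) ^ p * (-1) ^ (k : ℕ) *
      (endWeight m k * symCoeff m p τ (k : ℕ))) * thetaSym k m τ z := by
  have hz' := add_one_mem_domain2 hz
  rw [G1, Xi1, psi1_eq hm, psi2_eq_zero hm hτ hz', Upsilon1_eq, Upsilon2_eq hm p hτ hz',
    Finset.mul_sum, mul_zero, zero_sub, ← Finset.sum_neg_distrib]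
  refine Finset.sum_congr rfl fun k _ => ?_
  rw [thetaSym_add_one hm]
  ring

/-! ### Linear independence of the functions `θ_{k,m} + θ_{-k,m}` -/

lemma integral_qpow_half (n : ℤ) :
    ∫ x in (0 : ℝ)..2, qpow x (n / 2) = if n = 0 then 2 else 0 := by
  split_ifs with h
  · simp [h]
  · have hc : (Real.pi * I * n : ℂ) ≠ 0 :=
      mul_ne_zero (mul_ne_zero (by exact_mod_cast Real.pi_ne_zero) I_ne_zero) (by exact_mod_cast h)
    have e : ∀ x : ℝ, qpow x (n / 2) = cexp (Real.pi * I * n * x) := by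
      intro x; rw [qpow]; congr 1; push_cast; ring
    simp only [e]
    rw [integral_exp_mul_complex hc]
    have : cexp (Real.pi * I * n * (2 : ℝ)) = 1 :=
      Complex.exp_eq_one_iff.mpr ⟨n, by push_cast; ring⟩
    rw [this]
    simp

lemma norm_qpow_ofReal (x r : ℝ) : ‖qpow x r‖ = 1 := by
  rw [norm_qpow]; simp

lemma qpow_continuous (r : ℝ) : Continuous fun x : ℝ => qpow x r := by
  unfold qpow; fun_prop

lemma integral_theta_mul {m : ℕ} (hm : 0 < m) (t N : ℤ) {τ : ℂ} (hτ : 0 < τ.im) :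
    ∫ x in (0 : ℝ)..2, theta 1 t m τ x * qpow x (-(N / 2)) =
      if (2 * m : ℤ) ∣ N - t then 2 * qpow τ ((N : ℝ) ^ 2 / (4 * m)) else 0 := by
  have hs : Summable fun n : ℤ => ‖qpow τ ((t + 2 * m * n : ℤ) ^ 2 / (4 * m))‖ := by
    have h := (hasSum_theta_one hm t hτ 0).summable.norm
    refine h.congr fun n => ?_
    rw [norm_mul]
    simp [qpow]
  have h := intervalIntegral.hasSum_integral_of_dominated_convergence (a := 0) (b := 2)
    (μ := MeasureTheory.volume)
    (F := fun (n : ℤ) (x : ℝ) => qpow τ ((t + 2 * m * n : ℤ) ^ 2 / (4 * m)) *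
      qpow x ((t + 2 * m * n : ℤ) / 2) * qpow x (-(N / 2)))
    (f := fun x : ℝ => theta 1 t m τ x * qpow x (-(N / 2)))
    (fun n _ => ‖qpow τ ((t + 2 * m * n : ℤ) ^ 2 / (4 * m))‖)
    (fun n => (((qpow_continuous _).const_mul _).mul (qpow_continuous _)).aestronglyMeasurable)
    (fun n => Filter.Eventually.of_forall fun x _ => by
      rw [norm_mul, norm_mul, norm_qpow_ofReal, norm_qpow_ofReal, mul_one, mul_one])
    (Filter.Eventually.of_forall fun x _ => hs) (by simp)
    (Filter.Eventually.of_forall fun x _ => (hasSum_theta_one hm t hτ x).mul_right _)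
  have e : ∀ n : ℤ, ∫ x in (0 : ℝ)..2, qpow τ ((t + 2 * m * n : ℤ) ^ 2 / (4 * m)) *
      qpow x ((t + 2 * m * n : ℤ) / 2) * qpow x (-(N / 2)) =
      qpow τ ((t + 2 * m * n : ℤ) ^ 2 / (4 * m)) * if t + 2 * m * n - N = 0 then 2 else 0 := by
    intro n
    rw [← integral_qpow_half, ← intervalIntegral.integral_const_mul]
    congr 1
    ext x
    rw [mul_assoc, ← qpow_add]
    congr 2; push_cast; ring
  simp only [e] at h
  rw [← h.tsum_eq]
  split_ifs with hd
  · obtain ⟨n, hn⟩ := hd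
    have hn' : t + 2 * m * n = N := by linarith
    rw [tsum_eq_single n, hn', sub_self, if_pos rfl, mul_comm]
    intro l hl
    rw [if_neg, mul_zero]
    intro h0
    apply hl
    have : (2 * m : ℤ) * l = 2 * m * n := by linarith
    exact mul_left_cancel₀ (by positivity) this
  · refine (tsum_congr fun n => ?_).trans tsum_zero
    rw [if_neg, mul_zero]
    intro h0
    exact hd ⟨n, by linarith⟩

lemma integral_thetaSym_mul {m : ℕ} (hm : 0 < m) (k : ℕ) (N : ℤ) {τ : ℂ} (hτ : 0 < τ.im) :
    ∫ x in (0 : ℝ)..2, thetaSym k m τ x * qpow x (-(N / 2)) =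
      (if (2 * m : ℤ) ∣ N - k then 2 * qpow τ ((N : ℝ) ^ 2 / (4 * m)) else 0) +
      if (2 * m : ℤ) ∣ N - -k then 2 * qpow τ ((N : ℝ) ^ 2 / (4 * m)) else 0 := by
  have hm' : (0 : ℝ) < m := by positivity
  have hc : ∀ t : ℤ, IntervalIntegrable (fun x : ℝ => theta 1 t m τ x * qpow x (-(N / 2)))
      MeasureTheory.volume 0 2 := fun t =>
    (((theta_differentiable t hm' hτ).continuous.comp Complex.continuous_ofReal).mul
      (qpow_continuous _)).intervalIntegrable _ _
  rw [← integral_theta_mul hm _ _ hτ, ← integral_theta_mul hm _ _ hτ,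
    ← intervalIntegral.integral_add (hc _) (hc _)]
  congr 1
  ext x
  rw [thetaSym]
  push_cast
  ring

/-- Fourier exponents of the `k`-th function are `≡ ±k` modulo `2m`. For `0 ≤ k ≤ m` these classes
are disjoint, so the `i`-th Fourier coefficient isolates `d i`. -/
lemma eq_zero_of_sum_thetaSym_eq_zero {m : ℕ} (hm : 0 < m) {τ : ℂ} (hτ : 0 < τ.im)
    {d : Fin (m + 1) → ℂ} (h : ∀ x : ℝ, ∑ k, d k * thetaSym k m τ x = 0) : d = 0 := by
  ext i
  have hi := i.2
  have h1 : ∫ x in (0 : ℝ)..2, ∑ k, d k * (thetaSym k m τ x * qpow x (-(((i : ℕ) : ℤ) / 2))) = 0 := by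
    have h0 : ∀ x : ℝ,
        ∑ k, d k * (thetaSym k m τ x * qpow x (-(((i : ℕ) : ℤ) / 2))) = 0 := by
      intro x
      simp only [← mul_assoc]
      rw [← Finset.sum_mul, h, zero_mul]
    simp only [h0, intervalIntegral.integral_zero]
  rw [intervalIntegral.integral_finsetSum] at h1
  · simp only [intervalIntegral.integral_const_mul, integral_thetaSym_mul hm _ _ hτ] at h1
    rw [Finset.sum_eq_single i] at h1
    · have hq := qpow_ne_zero τ ((((i : ℕ) : ℤ) : ℝ) ^ 2 / (4 * m))
      rw [sub_self, if_pos (dvd_zero _)] at h1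
      refine (mul_eq_zero.mp h1).resolve_right ?_
      split_ifs
      · rw [← two_mul]; exact mul_ne_zero two_ne_zero (mul_ne_zero two_ne_zero hq)
      · rw [add_zero]; exact mul_ne_zero two_ne_zero hq
    · intro k _ hk
      have hk' := k.2
      have hki : (k : ℕ) ≠ i := fun h => hk (Fin.ext h)
      rw [if_neg, if_neg, add_zero, mul_zero]
      · rintro ⟨n, hn⟩
        rcases lt_trichotomy n 0 with h0 | h0 | h0
        · nlinarith
        · subst h0; omega
        · rcases eq_or_lt_of_le (by omega : 1 ≤ n) with h1 | h1
          · subst h1; omega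
          · nlinarith
      · rintro ⟨n, hn⟩
        rcases lt_trichotomy n 0 with h0 | h0 | h0
        · nlinarith
        · subst h0; omega
        · nlinarith
    · simp
  · intro k _
    exact ((((thetaSym_differentiable hm k hτ).continuous.comp Complex.continuous_ofReal).mul
      (qpow_continuous _)).const_mul _).intervalIntegrable _ _

lemma ofReal_mem_domain2 {τ : ℂ} (hτ : 0 < τ.im) (x : ℝ) : (x : ℂ) ∈ domain2 τ := by
  have key : ∀ b : ℤ, τ.im / 2 ≠ b * τ.im := by
    intro b h
    have : (1 : ℝ) = ((2 * b : ℤ) : ℝ) := by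
      push_cast
      refine mul_right_cancel₀ hτ.ne' ?_
      linarith
    have : (1 : ℤ) = 2 * b := by exact_mod_cast this
    omega
  constructor
  · rintro ⟨a, b, h⟩
    have := congrArg Complex.im h
    simp at this
    exact key b this
  · rintro ⟨a, b, h⟩
    have := congrArg Complex.im h
    simp at this
    exact key (-b) (by push_cast; linarith)

lemma ofReal_mem_domain1 {τ : ℂ} (hτ : 0 < τ.im) (x : ℝ) : (x : ℂ) ∈ domain1 τ := by
  have := sub_one_mem_domain1 (ofReal_mem_domain2 hτ (x + 1))
  simpa using this

lemma eq_of_sum_thetaSym_eq {m : ℕ} (hm : 0 < m) {τ : ℂ} (hτ : 0 < τ.im)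
    {d d' : Fin (m + 1) → ℂ}
    (h : ∀ x : ℝ, ∑ k, d k * thetaSym k m τ x = ∑ k, d' k * thetaSym k m τ x) : d = d' := by
  rw [← sub_eq_zero]
  refine eq_zero_of_sum_thetaSym_eq_zero hm hτ fun x => ?_
  simp only [Pi.sub_apply, sub_mul, Finset.sum_sub_distrib, h, sub_self]

lemma isCoeff1_iff {m : ℕ} (hm : 0 < m) (p : ℕ) {τ : ℂ} (hτ : 0 < τ.im)
    (g : Fin (m + 1) → ℂ) : IsCoeff1 m p τ g ↔
      g = fun k : Fin (m + 1) => -((-1) ^ p * (-1) ^ (k : ℕ) * (endWeight m k * symCoeff m p τ (k : ℕ))) := by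
  refine ⟨fun h => eq_of_sum_thetaSym_eq hm hτ fun x => ?_, fun h z hz => ?_⟩
  · rw [← h _ (ofReal_mem_domain1 hτ x), G1_eq hm p hτ (ofReal_mem_domain1 hτ x)]
  · rw [G1_eq hm p hτ hz, h]

lemma isCoeff2_iff {m : ℕ} (hm : 0 < m) (p : ℕ) {τ : ℂ} (hτ : 0 < τ.im)
    (g : Fin (m + 1) → ℂ) : IsCoeff2 m p τ g ↔
      g = fun k : Fin (m + 1) => -(endWeight m k * symCoeff m p τ (k : ℕ)) := by
  refine ⟨fun h => eq_of_sum_thetaSym_eq hm hτ fun x => ?_, fun h z hz => ?_⟩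
  · rw [← h _ (ofReal_mem_domain2 hτ x), G2_eq hm p hτ (ofReal_mem_domain2 hτ x)]
  · rw [G2_eq hm p hτ hz, h]

/-! ### The coefficients as indefinite theta series -/

lemma tsum_sub_tsum_eq_of_weight {ι : Type*} {P N : Set ι} {w f : ι → ℂ}
    (hP : ∀ x ∈ P, w x = 1) (hN : ∀ x ∈ N, w x = -1) (h0 : ∀ x, x ∉ P → x ∉ N → w x = 0)
    (hs : Summable fun x => w x * f x) :
    (Summable (fun x : P => f x) ∧ Summable (fun x : N => f x)) ∧
      ∑' x : P, f x - ∑' x : N, f x = ∑' x, w x * f x := by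
  have s1 : Summable (P.indicator f) := by
    refine (hs.indicator P).congr fun x => ?_
    by_cases hx : x ∈ P <;> simp [hx, hP]
  have s2 : Summable (N.indicator f) := by
    refine (hs.neg.indicator N).congr fun x => ?_
    by_cases hx : x ∈ N <;> simp [hx, hN]
  refine ⟨⟨summable_subtype_iff_indicator.mpr s1, summable_subtype_iff_indicator.mpr s2⟩, ?_⟩
  rw [tsum_subtype, tsum_subtype, ← s1.tsum_sub s2]
  refine tsum_congr fun x => ?_
  by_cases h1 : x ∈ P <;> by_cases h2 : x ∈ N
  · have := (hP x h1).symm.trans (hN x h2)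
    norm_num at this
  · simp [h1, h2, hP]
  · simp [h1, h2, hN]
  · simp [h1, h2, h0]

lemma zero_le_half_iff (n : ℤ) : 0 ≤ half n ↔ 0 ≤ n := by
  rw [half]
  constructor
  · intro h
    by_contra hn
    have : (n : ℝ) ≤ -1 := by exact_mod_cast (by omega : n ≤ -1)
    linarith
  · intro h
    have : (0 : ℝ) ≤ n := by exact_mod_cast h
    linarith

lemma half_lt_zero_iff (n : ℤ) : half n < 0 ↔ n < 0 := by
  rw [← not_le, zero_le_half_iff, not_le]

lemma half_le_half_iff (a b : ℤ) : half a ≤ half b ↔ a ≤ b := by simp [half]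

lemma half_lt_half_iff (a b : ℤ) : half a < half b ↔ a < b := by simp [half]

/-- In these coordinates the cone with vertex `(p, 0)` is `0 ≤ r ≤ j`, and the opposite one is `j <
r < 0`. -/
lemma quotTerm_weak {m : ℕ} (hm : 0 < m) (p : ℕ) (k : ℤ) (τ : ℂ) (j r : ℤ) :
    quotTerm m p k τ (r + p, r - j) * qpow τ (-((k : ℝ) ^ 2 / (4 * m))) =
      (-1) ^ p * term m p (-k) τ (j, r) := by
  have hm' : (m : ℝ) ≠ 0 := by positivity
  have hM : (2 * m + 1 : ℝ) ≠ 0 := by positivity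
  have hM' : (4 * m + 2 : ℝ) ≠ 0 := by positivity
  rw [quotTerm, term, mul_assoc, mul_assoc, ← qpow_add, ← qpow_add, ← mul_assoc,
    ← zpow_natCast (-1 : ℂ) p, ← zpow_add₀ (by norm_num)]
  congr 1
  · exact neg_one_zpow_eq (r - j) (by ring)
  · congr 1
    simp only [half]
    push_cast
    field_simp
    ring

/-- Here the cone with vertex `(-p, 0)` becomes `j ≤ r < 0` and the opposite one `0 ≤ r < j`. The
roles are exchanged, which the minus sign of the term compensates. -/
lemma quotTerm_strict {m : ℕ} (hm : 0 < m) (p : ℕ) (k : ℤ) (τ : ℂ) (j r : ℤ) :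
    quotTerm m (-p) k τ (-1 - r - p, j - r) * qpow τ (-((k : ℝ) ^ 2 / (4 * m))) =
      -((-1) ^ p * term m p k τ (j, r)) := by
  have hm' : (m : ℝ) ≠ 0 := by positivity
  have hM : (2 * m + 1 : ℝ) ≠ 0 := by positivity
  have hM' : (4 * m + 2 : ℝ) ≠ 0 := by positivity
  rw [quotTerm, term, mul_assoc, mul_assoc, ← qpow_add, ← qpow_add, ← mul_assoc,
    ← zpow_natCast (-1 : ℂ) p, ← zpow_add₀ (by norm_num), ← neg_mul]
  congr 1
  · exact neg_one_zpow_eq_neg (-r - p - 1) (by ring)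
  · congr 1
    simp only [half]
    push_cast
    field_simp
    ring

/-- The change of variables `(j, r) ↦ (r + p, r - j)`. -/
def weakEquiv (p : ℤ) : ℤ × ℤ ≃ ℤ × ℤ :=
  ⟨fun x => (x.2 + p, x.2 - x.1), fun x => (x.1 - p - x.2, x.1 - p), fun x => by simp,
    fun x => by simp⟩

/-- The change of variables `(j, r) ↦ (-1 - r - p, j - r)`. -/
def strictEquiv (p : ℤ) : ℤ × ℤ ≃ ℤ × ℤ :=
  ⟨fun x => (-1 - x.2 - p, x.1 - x.2), fun x => (x.2 - 1 - p - x.1, -1 - p - x.1),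
    fun x => Prod.ext (by ring) (by ring), fun x => Prod.ext (by ring) (by ring)⟩

lemma coneWeight_weakEquiv (p : ℤ) (x : ℤ × ℤ) : coneWeight p 0 (weakEquiv p x) =
    (if 0 ≤ x.2 then 1 else 0) + (if x.2 ≤ x.1 then 1 else 0) - 1 := by
  have h1 : p ≤ (weakEquiv p x).1 ↔ 0 ≤ x.2 := by simp [weakEquiv]
  have h2 : (weakEquiv p x).2 ≤ 0 ↔ x.2 ≤ x.1 := by simp [weakEquiv]
  simp only [coneWeight, h1, h2]

lemma neg_coneWeight_strictEquiv (p : ℤ) (x : ℤ × ℤ) : -coneWeight (-p) 0 (strictEquiv p x) =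
    (if 0 ≤ x.2 then 1 else 0) + (if x.2 < x.1 then 1 else 0) - 1 := by
  have h1 : -p ≤ (strictEquiv p x).1 ↔ ¬ 0 ≤ x.2 := by
    simp only [strictEquiv, Equiv.coe_fn_mk]; omega
  have h2 : (strictEquiv p x).2 ≤ 0 ↔ ¬ x.2 < x.1 := by
    simp only [strictEquiv, Equiv.coe_fn_mk]; omega
  simp only [coneWeight, h1, h2]
  split_ifs <;> norm_num

lemma coneSum_eq_sumWeak {m : ℕ} (hm : 0 < m) (p : ℕ) (k : ℤ) {τ : ℂ} (hτ : 0 < τ.im) :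
    SummableWeak (term m p (-k) τ) ∧
    coneSum p 0 (quotTerm m p k τ) * qpow τ (-((k : ℝ) ^ 2 / (4 * m))) =
      (-1) ^ p * sumWeak (term m p (-k) τ) := by
  have hs := (((weakEquiv p).summable_iff.mpr
    (summable_coneWeight_mul_quotTerm m p k p 0 hτ).of_norm).mul_right
    (qpow τ (-((k : ℝ) ^ 2 / (4 * m))))).mul_left ((-1) ^ p)
  have e : ∀ x : ℤ × ℤ, (-1) ^ p * (((fun x => coneWeight p 0 x * quotTerm m p k τ x) ∘ weakEquiv p) x *
      qpow τ (-((k : ℝ) ^ 2 / (4 * m)))) =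
      coneWeight p 0 (weakEquiv p x) * term m p (-k) τ x := by
    intro x
    have h1 := quotTerm_weak hm p k τ x.1 x.2
    have h2 : ((-1 : ℂ) ^ p) * (-1) ^ p = 1 := by rw [← mul_pow]; simp
    simp only [Function.comp_apply, weakEquiv, Equiv.coe_fn_mk]
    rw [mul_assoc, h1]
    linear_combination coneWeight p 0 (x.2 + p, x.2 - x.1) * term m p (-k) τ x * h2
  have h := tsum_sub_tsum_eq_of_weight (P := posWeak) (N := negWeak) ?_ ?_ ?_ (hs.congr e)
  · refine ⟨h.1, ?_⟩
    rw [sumWeak, h.2, ← tsum_congr e, tsum_mul_left, tsum_mul_right,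
      ← mul_assoc, ← mul_pow]
    have := (weakEquiv p).tsum_eq fun x => coneWeight p 0 x * quotTerm m p k τ x
    simp only [Function.comp_apply]
    rw [this, coneSum]
    norm_num
  all_goals
    intro x
    simp only [posWeak, negWeak, Set.mem_ofPred_eq, zero_le_half_iff, half_le_half_iff,
      half_lt_half_iff, half_lt_zero_iff, coneWeight_weakEquiv]
  · intro hx
    rw [if_pos (by omega), if_pos (by omega)]; norm_num
  · intro hx
    rw [if_neg (by omega), if_neg (by omega)]; norm_num
  · intro h1 h2
    by_cases h3 : 0 ≤ x.2
    · rw [if_pos (by omega), if_neg (by omega)]; norm_num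
    · rw [if_neg (by omega), if_pos (by omega)]; norm_num

lemma coneSum_eq_sumStrict {m : ℕ} (hm : 0 < m) (p : ℕ) (k : ℤ) {τ : ℂ} (hτ : 0 < τ.im) :
    SummableStrict (term m p k τ) ∧
    coneSum (-p) 0 (quotTerm m (-p) k τ) * qpow τ (-((k : ℝ) ^ 2 / (4 * m))) =
      (-1) ^ p * sumStrict (term m p k τ) := by
  have hs := (((strictEquiv p).summable_iff.mpr
    (summable_coneWeight_mul_quotTerm m (-p) k (-p) 0 hτ).of_norm).mul_right
    (qpow τ (-((k : ℝ) ^ 2 / (4 * m))))).mul_left ((-1) ^ p)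
  have e : ∀ x : ℤ × ℤ, (-1) ^ p *
      (((fun x => coneWeight (-p) 0 x * quotTerm m (-p) k τ x) ∘ strictEquiv p) x *
      qpow τ (-((k : ℝ) ^ 2 / (4 * m)))) =
      -coneWeight (-p) 0 (strictEquiv p x) * term m p k τ x := by
    intro x
    have h1 := quotTerm_strict hm p k τ x.1 x.2
    have h2 : ((-1 : ℂ) ^ p) * (-1) ^ p = 1 := by rw [← mul_pow]; simp
    simp only [Function.comp_apply, strictEquiv, Equiv.coe_fn_mk]
    rw [mul_assoc, h1]
    linear_combination -coneWeight (-p) 0 (-1 - x.2 - p, x.1 - x.2) * term m p k τ x * h2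
  have h := tsum_sub_tsum_eq_of_weight (P := posStrict) (N := negStrict) ?_ ?_ ?_ (hs.congr e)
  · refine ⟨h.1, ?_⟩
    rw [sumStrict, h.2, ← tsum_congr e, tsum_mul_left, tsum_mul_right,
      ← mul_assoc, ← mul_pow]
    have := (strictEquiv p).tsum_eq fun x => coneWeight (-p) 0 x * quotTerm m (-p) k τ x
    simp only [Function.comp_apply]
    rw [this, coneSum]
    norm_num
  all_goals
    intro x
    simp only [posStrict, negStrict, Set.mem_ofPred_eq, zero_le_half_iff, half_le_half_iff,
      half_lt_half_iff, half_lt_zero_iff, neg_coneWeight_strictEquiv]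
  · intro hx
    rw [if_pos (by omega), if_pos (by omega)]; norm_num
  · intro hx
    rw [if_neg (by omega), if_neg (by omega)]; norm_num
  · intro h1 h2
    by_cases h3 : 0 ≤ x.2
    · rw [if_pos (by omega), if_neg (by omega)]; norm_num
    · rw [if_neg (by omega), if_pos (by omega)]; norm_num

lemma thetaConst_eq_tsum (m p : ℕ) (τ : ℂ) :
    thetaConst m p τ = ∑' n : ℤ, (-1) ^ n *
      qpow τ ((m + 1 / 2) * (n + (2 * m * p + m + 1 / 2) / (2 * m + 1)) ^ 2) := by
  rw [thetaConst, theta_eq_tsum]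
  refine tsum_congr fun n => ?_
  have : ∀ x : ℝ, qpow 0 x = 1 := fun x => by simp [qpow]
  rw [this, mul_one, show (2 * (m + 1 / 2) : ℝ) = 2 * m + 1 by ring]

lemma thetaConst_zero (m : ℕ) (τ : ℂ) : thetaConst m 0 τ = 0 := by
  rw [thetaConst_eq_tsum]
  refine tsum_eq_zero_of_comp_equiv_eq_neg (reflect (-1)) fun n => ?_
  rw [← neg_mul, reflect_apply]
  congr 1
  · exact neg_one_zpow_eq_neg (-n - 1) (by ring)
  · congr 1
    have hM : (2 * m + 1 : ℝ) ≠ 0 := by positivity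
    push_cast
    field_simp
    ring

lemma quotCol_pos {m : ℕ} (hm : 0 < m) (p : ℕ) (k i : ℤ) (τ : ℂ) :
    quotCol m p k i τ * qpow τ (-((k : ℝ) ^ 2 / (4 * m))) =
      (-1) ^ p * (thetaConst m p τ * qpow τ (-(1 / (4 * m)) * (m * (2 * i + 1) - k) ^ 2)) := by
  rw [quotCol, thetaConst_eq_tsum, ← tsum_mul_right, ← tsum_mul_right, ← tsum_mul_left,
    ← (reflect (i - p)).tsum_eq]
  refine tsum_congr fun n => ?_
  have hm' : (m : ℝ) ≠ 0 := by positivity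
  have hM : (2 * m + 1 : ℝ) ≠ 0 := by positivity
  have hM' : (4 * m + 2 : ℝ) ≠ 0 := by positivity
  rw [quotTerm, mul_assoc, ← qpow_add, mul_assoc, ← qpow_add, ← mul_assoc, ← zpow_natCast (-1 : ℂ) p,
    ← zpow_add₀ (by norm_num), reflect_apply]
  congr 1
  · exact neg_one_zpow_eq (i - p - n) (by ring)
  · congr 1
    simp only [half]
    push_cast
    field_simp
    ring

lemma quotCol_neg {m : ℕ} (hm : 0 < m) (p : ℕ) (k i : ℤ) (τ : ℂ) :
    quotCol m (-p) k i τ * qpow τ (-((k : ℝ) ^ 2 / (4 * m))) =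
      -((-1) ^ p * (thetaConst m p τ * qpow τ (-(1 / (4 * m)) * (m * (2 * i + 1) - k) ^ 2))) := by
  rw [quotCol, thetaConst_eq_tsum, ← tsum_mul_right, ← tsum_mul_right, ← tsum_mul_left, ← tsum_neg,
    ← (Equiv.addRight (i + p + 1)).tsum_eq]
  refine tsum_congr fun n => ?_
  have hm' : (m : ℝ) ≠ 0 := by positivity
  have hM : (2 * m + 1 : ℝ) ≠ 0 := by positivity
  have hM' : (4 * m + 2 : ℝ) ≠ 0 := by positivity
  rw [quotTerm, mul_assoc, ← qpow_add, mul_assoc, ← qpow_add, ← mul_assoc, ← zpow_natCast (-1 : ℂ) p,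
    ← zpow_add₀ (by norm_num), Equiv.coe_addRight, ← neg_mul]
  congr 1
  · exact neg_one_zpow_eq_neg i (by ring)
  · congr 1
    simp only [half]
    push_cast
    field_simp
    ring

lemma quotCoeff_pos {m : ℕ} (hm : 0 < m) (p : ℕ) (k : ℤ) {τ : ℂ} (hτ : 0 < τ.im) :
    quotCoeff m p k τ * qpow τ (-((k : ℝ) ^ 2 / (4 * m))) =
      (-1) ^ p * (sumWeak (term m p (-k) τ) + thetaConst m p τ *
        ∑ i ∈ Finset.range p, qpow τ (-(1 / (4 * m)) * (m * (2 * i + 1) - k) ^ 2)) := by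
  have h := coneSum_quotTerm_add m p k 0 0 p hτ
  simp only [zero_add] at h
  rw [← quotCoeff, eq_sub_iff_add_eq] at h
  rw [← h, add_mul, (coneSum_eq_sumWeak hm p k hτ).2, Finset.sum_mul, mul_add, Finset.mul_sum,
    Finset.mul_sum]
  congr 1
  refine Finset.sum_congr rfl fun i _ => ?_
  rw [quotCol_pos hm]
  push_cast
  rfl

lemma quotCoeff_neg_left {m : ℕ} (hm : 0 < m) (p : ℕ) (k : ℤ) {τ : ℂ} (hτ : 0 < τ.im) :
    quotCoeff m (-p) k τ * qpow τ (-((k : ℝ) ^ 2 / (4 * m))) =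
      (-1) ^ p * (sumStrict (term m p k τ) + thetaConst m p τ *
        ∑ i ∈ Finset.range p, qpow τ (-(1 / (4 * m)) * (m * (2 * (i - p) + 1) - k) ^ 2)) := by
  have h := coneSum_quotTerm_add m (-p) k (-p) 0 p hτ
  rw [neg_add_cancel, ← quotCoeff] at h
  rw [h, sub_mul, (coneSum_eq_sumStrict hm p k hτ).2, Finset.sum_mul, mul_add, Finset.mul_sum,
    Finset.mul_sum, sub_eq_add_neg, ← Finset.sum_neg_distrib]
  congr 1
  refine Finset.sum_congr rfl fun i _ => ?_
  rw [quotCol_neg hm, neg_neg]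
  push_cast
  ring_nf

/-- The indices `-i` come from the columns crossed for `e = p`, the indices `p - i` from those for
`e = -p`. -/
lemma sum_Ioc_neg_self (p : ℕ) (F : ℤ → ℂ) :
    ∑ r ∈ Finset.Ioc (-(p : ℤ)) p, F r =
      ∑ i ∈ Finset.range p, F (-i) + ∑ i ∈ Finset.range p, F (p - i) := by
  have h : ∑ r ∈ Finset.Ioc (-(p : ℤ)) p, F r = ∑ i ∈ Finset.range (p + p), F (p - i) := by
    refine Finset.sum_nbij' (fun r => (p - r).toNat) (fun i => p - i) ?_ ?_ ?_ ?_ ?_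
    · intro r hr; simp only [Finset.mem_Ioc, Finset.mem_range] at *; omega
    · intro r hr; simp only [Finset.mem_Ioc, Finset.mem_range] at *; omega
    · intro r hr; simp only [Finset.mem_Ioc] at *; omega
    · intro r hr; simp
    · intro r hr; simp only [Finset.mem_Ioc] at hr; congr 1; omega
  rw [h, Finset.sum_range_add, add_comm]
  congr 1
  refine Finset.sum_congr rfl fun i _ => ?_
  congr 1
  push_cast
  ring

lemma symCoeff_eq {m : ℕ} (hm : 0 < m) (p k : ℕ) {τ : ℂ} (hτ : 0 < τ.im) :
    symCoeff m p τ k = (-1) ^ p * (sumStrict (term m p k τ) + sumWeak (term m p (-k) τ) +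
      thetaConst m p τ * ∑ r ∈ Finset.Ioc (-(p : ℤ)) (p : ℤ),
        qpow τ (-(1 / (4 * m)) * (m * (2 * r - 1) + k) ^ 2)) := by
  rw [symCoeff, add_mul, quotCoeff_pos hm p k hτ, quotCoeff_neg_left hm p k hτ,
    sum_Ioc_neg_self p fun r : ℤ => qpow τ (-(1 / (4 * m)) * (m * (2 * r - 1) + k) ^ 2)]
  have h1 : ∀ i : ℕ, qpow τ (-(1 / (4 * m)) * (m * (2 * ((-i : ℤ) : ℝ) - 1) + k) ^ 2) =
      qpow τ (-(1 / (4 * m)) * (m * (2 * i + 1) - (k : ℤ)) ^ 2) := by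
    intro i; congr 1; push_cast; ring
  have h2 : ∀ i : ℕ, qpow τ (-(1 / (4 * m)) * (m * (2 * ((p - i : ℤ) : ℝ) - 1) + k) ^ 2) =
      qpow τ (-(1 / (4 * m)) * (m * (2 * (i - p) + 1) - (k : ℤ)) ^ 2) := by
    intro i; congr 1; push_cast; ring
  simp only [h1, h2]
  push_cast
  ring

lemma termSq_zero {m : ℕ} (hm : 0 < m) (p : ℕ) (τ : ℂ) : termSq m p 0 τ = term m p (-(0 : ℤ)) τ := by
  have hm' : (m : ℝ) ≠ 0 := by positivity
  ext x
  rw [termSq, term, mul_assoc ((-1 : ℂ) ^ x.1), ← qpow_add]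
  congr 2
  push_cast
  field_simp
  ring

lemma termSq_neg_half {m : ℕ} (hm : 0 < m) (p : ℕ) (τ : ℂ) :
    termSq m p (-1 / 2) τ = term m p (-(m : ℤ)) τ := by
  have hm' : (m : ℝ) ≠ 0 := by positivity
  ext x
  rw [termSq, term, mul_assoc ((-1 : ℂ) ^ x.1), ← qpow_add]
  congr 2
  push_cast
  field_simp
  ring

/-- At `N = 0` the coefficients for `e = p` and `e = -p` agree by the symmetry `N ↦ -N`, so only
weak sums occur, doubled. -/
lemma symCoeff_zero {m : ℕ} (hm : 0 < m) (p : ℕ) {τ : ℂ} (hτ : 0 < τ.im) :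
    symCoeff m p τ 0 = (-1) ^ p * (2 * sumWeak (termSq m p 0 τ) +
      2 * thetaConst m p τ * ∑ r ∈ Finset.range p, qpow τ (-m * ((r : ℝ) + 1 / 2) ^ 2)) := by
  have h := quotCoeff_neg m p 0 hτ
  rw [neg_zero] at h
  rw [symCoeff, ← h, ← two_mul, mul_assoc, quotCoeff_pos hm p 0 hτ, termSq_zero hm]
  have hm' : (m : ℝ) ≠ 0 := by positivity
  have h1 : ∀ i : ℕ, qpow τ (-(1 / (4 * m)) * (m * (2 * i + 1) - (0 : ℤ)) ^ 2) =
      qpow τ (-m * ((i : ℝ) + 1 / 2) ^ 2) := by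
    intro i; congr 1; push_cast; field_simp; ring
  simp only [h1]
  ring

lemma sum_Ioo_neg_self (p : ℕ) (F : ℤ → ℂ) (hF : ∀ r, F (-r) = F r) :
    ∑ r ∈ Finset.Ioo (-((p + 1 : ℕ) : ℤ)) (p + 1 : ℕ), F r =
      2 * ∑ i ∈ Finset.range (p + 1), F i - F 0 := by
  induction p with
  | zero =>
    have : Finset.Ioo (-((0 + 1 : ℕ) : ℤ)) (0 + 1 : ℕ) = {0} := by
      ext x; simp only [Finset.mem_Ioo, Finset.mem_singleton]; omega
    rw [this]; simp; ring
  | succ p ih =>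
    have : Finset.Ioo (-((p + 1 + 1 : ℕ) : ℤ)) (p + 1 + 1 : ℕ) =
        insert ((p + 1 : ℕ) : ℤ) (insert (-((p + 1 : ℕ) : ℤ))
          (Finset.Ioo (-((p + 1 : ℕ) : ℤ)) (p + 1 : ℕ))) := by
      ext x; simp only [Finset.mem_Ioo, Finset.mem_insert]; omega
    rw [this, Finset.sum_insert, Finset.sum_insert, ih, Finset.sum_range_succ _ (p + 1), hF]
    · ring
    · simp
    · simp only [Finset.mem_Ioo, Finset.mem_insert]; omega

/-- Reflection and quasi-periodicity from `-m` to `m` (with factor `q^0`) express the coefficient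
for `-p` by that for `p` minus one column. This column is Θ times the term `r = 0`, counted twice in
the doubled sum. -/
lemma symCoeff_self {m : ℕ} (hm : 0 < m) (p : ℕ) {τ : ℂ} (hτ : 0 < τ.im) :
    symCoeff m p τ m = (-1) ^ p * (2 * sumWeak (termSq m p (-1 / 2) τ) +
      thetaConst m p τ * ∑ r ∈ Finset.Ioo (-(p : ℤ)) (p : ℤ), qpow τ (-m * (r : ℝ) ^ 2)) := by
  have hm' : (m : ℝ) ≠ 0 := by positivity
  have h1 := quotCoeff_neg m p m hτ
  have h2 := quotCoeff_add_two_mul m p (-m) hτ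
  rw [show (-(m : ℤ)) + 2 * m = m by ring] at h2
  push_cast at h2
  rw [neg_add_cancel, qpow_zero, one_mul, h1] at h2
  have h3 := quotCol_pos hm p (-m) (-1) τ
  push_cast at h3
  rw [show (m * (2 * (-1) + 1) - -m : ℝ) = 0 by ring] at h3
  simp only [ne_eq, OfNat.ofNat_ne_zero, not_false_eq_true, zero_pow, mul_zero, qpow_zero,
    mul_one, neg_sq] at h3
  have h4 := quotCoeff_pos hm p m hτ
  have h5 : ∀ i : ℕ, qpow τ (-(1 / (4 * m)) * (m * (2 * i + 1) - (m : ℤ)) ^ 2) =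
      qpow τ (-m * ((i : ℤ) : ℝ) ^ 2) := by
    intro i; congr 1; push_cast; field_simp; ring
  simp only [h5] at h4
  rw [← termSq_neg_half hm] at h4
  push_cast at h4
  have h6 : thetaConst m p τ * ∑ r ∈ Finset.Ioo (-(p : ℤ)) (p : ℤ), qpow τ (-m * (r : ℝ) ^ 2) =
      thetaConst m p τ * (2 * ∑ i ∈ Finset.range p, qpow τ (-m * (i : ℝ) ^ 2) - 1) := by
    -- For `p = 0` the open interval is empty and the bracket is `-1`; the identity survives because
    -- Θ vanishes.
    rcases p with _ | p
    · rw [thetaConst_zero]; simp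
    · rw [sum_Ioo_neg_self p (fun r : ℤ => qpow τ (-m * (r : ℝ) ^ 2)) (fun r => by push_cast; ring_nf)]
      simp
  rw [h6, symCoeff]
  push_cast
  linear_combination 2 * h4 - qpow τ (-((m : ℝ) ^ 2 / (4 * m))) * h2 - h3

/-! ### Weights at the end points -/

lemma sumStrict_const_mul (c : ℂ) (f : ℤ × ℤ → ℂ) :
    sumStrict (fun x => c * f x) = c * sumStrict f := by
  simp only [sumStrict, tsum_mul_left, mul_sub]

lemma sumWeak_const_mul (c : ℂ) (f : ℤ × ℤ → ℂ) :
    sumWeak (fun x => c * f x) = c * sumWeak f := by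
  simp only [sumWeak, tsum_mul_left, mul_sub]

lemma endWeight_zero {m : ℕ} (hm : 0 < m) : endWeight m 0 = 1 / 2 := by
  rw [endWeight, if_pos rfl, if_neg hm.ne]; norm_num

lemma endWeight_self {m : ℕ} (hm : 0 < m) : endWeight m m = 1 / 2 := by
  rw [endWeight, if_pos rfl, if_neg hm.ne']; norm_num

lemma endWeight_of_lt {m k : ℕ} (h0 : 0 < k) (h1 : k < m) : endWeight m k = 1 := by
  rw [endWeight, if_neg h0.ne', if_neg h1.ne]; norm_num

end IndefTheta

end

theorem propositionm1 (m : ℕ) (hm : 0 < m) (p : ℕ) (hp : p ≤ 2 * m) (τ : ℂ) (hτ : 0 < τ.im) :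
    -- all the double series that occur below converge absolutely
    ((∀ k : ℕ, 0 < k → k < m →
        IndefTheta.SummableStrict (IndefTheta.term m p k τ) ∧
        IndefTheta.SummableWeak (IndefTheta.term m p (-k) τ)) ∧
      IndefTheta.SummableWeak (IndefTheta.termSq m p 0 τ) ∧
      IndefTheta.SummableWeak (IndefTheta.termSq m p (-1 / 2) τ)) ∧
    -- the coefficients of both functions exist and are unique
    (∃! g : Fin (m + 1) → ℂ, IndefTheta.IsCoeff1 m p τ g) ∧
    (∃! g : Fin (m + 1) → ℂ, IndefTheta.IsCoeff2 m p τ g) ∧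
    -- explicit formulas, first family
    (∀ g : Fin (m + 1) → ℂ, IndefTheta.IsCoeff1 m p τ g →
      (∀ k : Fin (m + 1), 0 < (k : ℕ) → (k : ℕ) < m →
        g k =
          - IndefTheta.sumStrict (fun x => (-1) ^ (k : ℕ) * IndefTheta.term m p (k : ℕ) τ x)
          - IndefTheta.sumWeak (fun x => (-1) ^ (k : ℕ) * IndefTheta.term m p (-(k : ℕ)) τ x)
          - IndefTheta.thetaConst m p τ * ∑ r ∈ Finset.Ioc (-(p : ℤ)) (p : ℤ),
              (-1) ^ (k : ℕ) *
                IndefTheta.qpow τ (-(1 / (4 * m)) * (m * (2 * r - 1) + (k : ℕ)) ^ 2)) ∧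
      2 * g 0 =
          - 2 * IndefTheta.sumWeak (IndefTheta.termSq m p 0 τ)
          - 2 * IndefTheta.thetaConst m p τ * ∑ r ∈ Finset.range p,
              IndefTheta.qpow τ (-m * ((r : ℝ) + 1 / 2) ^ 2) ∧
      2 * g (Fin.last m) =
          - 2 * (-1) ^ m * IndefTheta.sumWeak (IndefTheta.termSq m p (-1 / 2) τ)
          - (-1) ^ m * IndefTheta.thetaConst m p τ *
              ∑ r ∈ Finset.Ioo (-(p : ℤ)) (p : ℤ), IndefTheta.qpow τ (-m * (r : ℝ) ^ 2)) ∧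
    -- explicit formulas, second family
    (∀ g : Fin (m + 1) → ℂ, IndefTheta.IsCoeff2 m p τ g →
      (∀ k : Fin (m + 1), 0 < (k : ℕ) → (k : ℕ) < m →
        g k =
          - (-1) ^ p * IndefTheta.sumStrict (IndefTheta.term m p (k : ℕ) τ)
          - (-1) ^ p * IndefTheta.sumWeak (IndefTheta.term m p (-(k : ℕ)) τ)
          - (-1) ^ p * IndefTheta.thetaConst m p τ * ∑ r ∈ Finset.Ioc (-(p : ℤ)) (p : ℤ),
              IndefTheta.qpow τ (-(1 / (4 * m)) * (m * (2 * r - 1) + (k : ℕ)) ^ 2)) ∧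
      2 * g 0 =
          - 2 * (-1) ^ p * IndefTheta.sumWeak (IndefTheta.termSq m p 0 τ)
          - 2 * (-1) ^ p * IndefTheta.thetaConst m p τ * ∑ r ∈ Finset.range p,
              IndefTheta.qpow τ (-m * ((r : ℝ) + 1 / 2) ^ 2) ∧
      2 * g (Fin.last m) =
          - 2 * (-1) ^ p * IndefTheta.sumWeak (IndefTheta.termSq m p (-1 / 2) τ)
          - (-1) ^ p * IndefTheta.thetaConst m p τ *
              ∑ r ∈ Finset.Ioo (-(p : ℤ)) (p : ℤ), IndefTheta.qpow τ (-m * (r : ℝ) ^ 2)) := by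
  have hw : ∀ k : ℕ, IndefTheta.SummableWeak (IndefTheta.term m p (-(k : ℝ)) τ) := fun k => by
    have := (IndefTheta.coneSum_eq_sumWeak hm p k hτ).1
    rwa [Int.cast_natCast] at this
  have hs : ∀ k : ℕ, IndefTheta.SummableStrict (IndefTheta.term m p k τ) := fun k => by
    have := (IndefTheta.coneSum_eq_sumStrict hm p k hτ).1
    rwa [Int.cast_natCast] at this
  -- In the first family the sign `(-1)^p` from the shift of `z` cancels the one inside `symCoeff`.
  have hp1 : ((-1 : ℂ) ^ p) * (-1) ^ p = 1 := by rw [← mul_pow]; simp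
  refine ⟨⟨fun k _ _ => ⟨hs k, hw k⟩, ?_, ?_⟩, ⟨_, (IndefTheta.isCoeff1_iff hm p hτ _).mpr rfl,
    fun g hg => (IndefTheta.isCoeff1_iff hm p hτ g).mp hg⟩,
    ⟨_, (IndefTheta.isCoeff2_iff hm p hτ _).mpr rfl,
    fun g hg => (IndefTheta.isCoeff2_iff hm p hτ g).mp hg⟩, fun g hg => ?_, fun g hg => ?_⟩
  · rw [IndefTheta.termSq_zero hm]
    exact (IndefTheta.coneSum_eq_sumWeak hm p 0 hτ).1
  · rw [IndefTheta.termSq_neg_half hm]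
    exact (IndefTheta.coneSum_eq_sumWeak hm p m hτ).1
  · rw [IndefTheta.isCoeff1_iff hm p hτ] at hg
    refine ⟨fun k h0 h1 => ?_, ?_, ?_⟩
    · rw [IndefTheta.sumStrict_const_mul, IndefTheta.sumWeak_const_mul, ← Finset.mul_sum, hg]
      simp only [IndefTheta.endWeight_of_lt h0 h1, IndefTheta.symCoeff_eq hm p k hτ]
      linear_combination -(-1) ^ (k : ℕ) * (IndefTheta.sumStrict (IndefTheta.term m p (k : ℕ) τ) +
        IndefTheta.sumWeak (IndefTheta.term m p (-(k : ℕ)) τ) +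
        IndefTheta.thetaConst m p τ * ∑ r ∈ Finset.Ioc (-(p : ℤ)) (p : ℤ),
          IndefTheta.qpow τ (-(1 / (4 * m)) * (m * (2 * r - 1) + (k : ℕ)) ^ 2)) * hp1
    · rw [hg]
      simp only [Fin.val_zero, Nat.cast_zero, IndefTheta.endWeight_zero hm,
        IndefTheta.symCoeff_zero hm p hτ]
      linear_combination -(2 * IndefTheta.sumWeak (IndefTheta.termSq m p 0 τ) +
        2 * IndefTheta.thetaConst m p τ * ∑ r ∈ Finset.range p,
          IndefTheta.qpow τ (-m * ((r : ℝ) + 1 / 2) ^ 2)) * hp1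
    · rw [hg]
      simp only [Fin.val_last, IndefTheta.endWeight_self hm, IndefTheta.symCoeff_self hm p hτ]
      linear_combination -(-1) ^ m * (2 * IndefTheta.sumWeak (IndefTheta.termSq m p (-1 / 2) τ) +
        IndefTheta.thetaConst m p τ *
          ∑ r ∈ Finset.Ioo (-(p : ℤ)) (p : ℤ), IndefTheta.qpow τ (-m * (r : ℝ) ^ 2)) * hp1
  · rw [IndefTheta.isCoeff2_iff hm p hτ] at hg
    refine ⟨fun k h0 h1 => ?_, ?_, ?_⟩
    · rw [hg]
      simp only [IndefTheta.endWeight_of_lt h0 h1, IndefTheta.symCoeff_eq hm p k hτ]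
      ring
    · rw [hg]
      simp only [Fin.val_zero, Nat.cast_zero, IndefTheta.endWeight_zero hm,
        IndefTheta.symCoeff_zero hm p hτ]
      ring
    · rw [hg]
      simp only [Fin.val_last, IndefTheta.endWeight_self hm, IndefTheta.symCoeff_self hm p hτ]
      ring
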